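/- **Setting.** Let $d\in\mathbb N$, $0<s<1$, and let $\Omega\subset\mathbb R^d$ be a bounded open set. Let $g:\mathbb R^d\times\mathbb R^d\times(0,\infty)\to(0,\infty)$ be measurable, with constants $0<g_*\le g^*$, such that for a.e. $(x,y)\in\mathbb R^d\times\mathbb R^d$, and also at $(x,x)$ for a.e. $x\in\mathbb R^d$: $g(x,y,\cdot)$ is locally Lipschitz on $(0,\infty)$, $rg(x,y,r)\to0$ as $r\to0^+$, $rg(x,y,r)\to+\infty$ as $r\to+\infty$, and $g_*\le \frac{r\,\partial_rg(x,y,r)}{g(x,y,r)}+1\le g^*$ for a.e. $r>0$. Put $G(x,y,r)=\int_0^r\rho\,g(x,y,\rho)\,d\rho$ and $\delta^su(x,y)=\frac{u(x)-u(y)}{|x-y|^s}$. Let $W^{s,G}(\mathbb R^d)$ be the space of measurable $u:\mathbb R^d\to\mathbb R$ with $\int_{\mathbb R^d} G(x,x,|u(x)|)\,dx<\infty$ and $\iint G(x,y,|\delta^su(x,y)|)\frac{dx\,dy}{|x-y|^d}<\infty$, with norm $\|u\|_{s,G}$ the sum of the two corresponding Luxemburg norms. For an open $U\subset\mathbb R^d$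 let $W^{s,G}_0(U)$ be the closure of $C_c^\infty(U)\cap W^{s,G}(\mathbb R^d)$ in $W^{s,G}(\mathbb R^d)$. Let $W^{-s,G^*}(\Omega)$ be the dual of $W_0^{s,G}(\Omega)$, ordered by $F\le F'$ iff $\langle F,v\rangle\le\langle F',v\rangle$ for all $v\in W^{s,G}_0(\Omega)$ with $v\ge0$ a.e.; $\vee$, $\wedge$ and $F^+=F\vee0$ denote least upper bounds, greatest lower bounds and the positive part in this ordered space. The order dual is $W^{-s,G^*}_\prec(\Omega)=\{A-B: A,B\in W^{-s,G^*}(\Omega),\ A,B\ge0\}$. For $u\in W^{s,G}(\mathbb R^d)$ define $\mathcal L_g^su\in W^{-s,G^*}(\Omega)$ by $$\langle\mathcal L_g^su,v\rangle=\iint g(x,y,|\delta^su|)\,\delta^su\,\delta^sv\,\frac{dx\,dy}{|x-y|^d},\qquad v\in W_0^{s,G}(\Omega).$$ Let $\psi,\varphi\in W^{s,G}(\mathbb R^d)$ be obstacles in the closure $W^{s,G}_0(\mathbb R^d)$ of the test functions, with $\psi\le0$ and (for two obstacles) $\varphi\ge0$ a.e. in $\mathbb R^d\setminus\Omega$. Let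 $$\mathbb K_1=\{v\in W^{s,G}_0(\Omega):v\ge\psi\text{ a.e. in }\Omega\},\qquad \mathbb K_2=\{v\in W^{s,G}_0(\Omega):\psi\le v\le\varphi\text{ a.e. in }\Omega\}.$$ For $F\in W^{-s,G^*}(\Omega)$, a solution of the one (resp. two) obstacle problem is a $u\in\mathbb K$ with $\langle\mathcal L_g^su-F,v-u\rangle\ge0$ for all $v\in\mathbb K$, where $\mathbb K=\mathbb K_1$ (resp. $\mathbb K=\mathbb K_2$). **Theorem.** (One obstacle.) Assume that $F\in W^{-s,G^*}_\prec(\Omega)$ and that $(\mathcal L_g^s\psi-F)^+$ exists and belongs to $W^{-s,G^*}_\prec(\Omega)$. Then, if $u$ is the solution of the one obstacle problem, $F\vee\mathcal L_g^s\psi$ exists in $W^{-s,G^*}(\Omega)$, $$F\le\mathcal L_g^su\le F\vee\mathcal L_g^s\psi\quad\text{in }W^{-s,G^*}(\Omega),$$ and $\mathcal L_g^su\in W^{-s,G^*}_\prec(\Omega)$. (Two obstacles.) Assume in addition that $(\mathcal L_g^s\varphi-F)^+$ exists and belongs to $W^{-s,G^*}_\prec(\Omega)$. Then, if $u$ is the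 solution of the two obstacles problem, $F\wedge\mathcal L_g^s\varphi$ and $F\vee\mathcal L_g^s\psi$ exist in $W^{-s,G^*}(\Omega)$, $$F\wedge\mathcal L_g^s\varphi\le\mathcal L_g^su\le F\vee\mathcal L_g^s\psi\quad\text{in }W^{-s,G^*}(\Omega),$$ and $\mathcal L_g^su\in W^{-s,G^*}_\prec(\Omega)$. -/

import Mathlib

open MeasureTheory Set Filter Topology
open scoped ENNReal NNReal ContDiff

namespace FracOrlicz

/-! ### The profile `r ↦ g(x,y,r)` for fixed `(x,y)` -/

/-- The conditions imposed on `h = g(x,y,·)` on `(0,∞)`, for a fixed pair `(x,y)`: positivity,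
local Lipschitz continuity, the two limits of `r h(r)`, and the growth condition
`a ≤ r h'(r) / h(r) + 1 ≤ b` (for a.e. `r > 0`: a Lipschitz function is differentiable a.e.). -/
structure IsProfile (a b : ℝ) (h : ℝ → ℝ) : Prop where
  pos : ∀ r, 0 < r → 0 < h r
  lipschitz : ∀ r R, 0 < r → ∃ K : ℝ≥0, LipschitzOnWith K h (Icc r R)
  tendsto_zero : Tendsto (fun r => r * h r) (𝓝[>] 0) (𝓝 0)
  tendsto_top : Tendsto (fun r => r * h r) atTop atTop
  growth : ∀ᵐ r : ℝ, 0 < r → a ≤ r * deriv h r / h r + 1 ∧ r * deriv h r / h r + 1 ≤ b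

/-- `prim h r = ∫₀ʳ ρ h(ρ) dρ`, as an extended nonnegative real. -/
noncomputable def prim (h : ℝ → ℝ) (r : ℝ) : ℝ≥0∞ :=
  ∫⁻ ρ in Ioc 0 r, ENNReal.ofReal (ρ * h ρ)

theorem le_of_ac {f : ℝ → ℝ} {r R : ℝ} (hrR : r ≤ R) (hf : AbsolutelyContinuousOnInterval f r R)
    (hd : ∀ᵐ x : ℝ, x ∈ Icc r R → 0 ≤ deriv f x) : f r ≤ f R := by
  have h1 := hf.integral_deriv_eq_sub
  have h2 : 0 ≤ ∫ x in r..R, deriv f x := by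
    apply intervalIntegral.integral_nonneg_of_ae_restrict hrR
    exact (ae_restrict_iff' measurableSet_Icc).2 hd
  linarith

theorem IsProfile.ac {a b : ℝ} {h : ℝ → ℝ} (H : IsProfile a b h) {r R : ℝ} (hr : 0 < r)
    (hrR : r ≤ R) : AbsolutelyContinuousOnInterval h r R := by
  obtain ⟨K, hK⟩ := H.lipschitz r R hr
  exact LipschitzOnWith.absolutelyContinuousOnInterval (by rwa [uIcc_of_le hrR])

theorem IsProfile.mono {a b : ℝ} {h : ℝ → ℝ} (ha : 0 < a) (H : IsProfile a b h) {r R : ℝ}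
    (hr : 0 < r) (hrR : r ≤ R) : r * h r ≤ R * h R := by
  have hid : AbsolutelyContinuousOnInterval (fun x : ℝ => x) r R :=
    LipschitzOnWith.absolutelyContinuousOnInterval (LipschitzWith.id.lipschitzOnWith)
  refine le_of_ac (f := fun x => x * h x) hrR (hid.fun_mul (H.ac hr hrR)) ?_
  filter_upwards [H.growth, (H.ac hr hrR).ae_differentiableAt] with x hx hdx hxm
  have hx0 : 0 < x := hr.trans_le hxm.1
  have hd := hdx (by rwa [uIcc_of_le hrR])
  have e : deriv (fun x => x * h x) x = h x + x * deriv h x := by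
    have := ((hasDerivAt_id x).mul hd.hasDerivAt).deriv
    simpa [Pi.mul_def] using this
  rw [e]
  have hp := H.pos x hx0
  have h1 := (hx hx0).1
  have h2 : x * deriv h x = (x * deriv h x / h x) * h x := by field_simp
  nlinarith

theorem IsProfile.double {a b : ℝ} {h : ℝ → ℝ} (H : IsProfile a b h) {r : ℝ}
    (hr : 0 < r) : (2 * r) * h (2 * r) ≤ 2 ^ b * (r * h r) := by
  have hrR : r ≤ 2 * r := by linarith
  have hpw : AbsolutelyContinuousOnInterval (fun x : ℝ => x ^ (1 - b)) r (2 * r) := by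
    apply ContDiffOn.absolutelyContinuousOnInterval
    intro x hx
    rw [uIcc_of_le hrR] at hx
    exact (Real.contDiffAt_rpow_const_of_ne (hr.trans_le hx.1).ne').contDiffWithinAt
  have key : -(r ^ (1 - b) * h r) ≤ -((2 * r) ^ (1 - b) * h (2 * r)) := by
    refine le_of_ac (f := fun x => -(x ^ (1 - b) * h x)) hrR
      ((hpw.fun_mul (H.ac hr hrR)).neg) ?_
    filter_upwards [H.growth, (H.ac hr hrR).ae_differentiableAt] with x hx hdx hxm
    have hx0 : 0 < x := hr.trans_le hxm.1
    have hd := hdx (by rwa [uIcc_of_le hrR])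
    have e : deriv (fun x => -(x ^ (1 - b) * h x)) x
        = -((1 - b) * x ^ (1 - b - 1) * h x + x ^ (1 - b) * deriv h x) := by
      have := (((Real.hasDerivAt_rpow_const (p := 1 - b) (Or.inl hx0.ne')).mul
        hd.hasDerivAt).neg).deriv
      simpa [Pi.mul_def, Pi.neg_def] using this
    rw [e]
    have hp := H.pos x hx0
    have h1 := (hx hx0).2
    have h2 : x * deriv h x = (x * deriv h x / h x) * h x := by field_simp
    have h3 : x ^ (1 - b) = x ^ (1 - b - 1) * x := by
      rw [Real.rpow_sub_one hx0.ne']; field_simp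
    have h4 : 0 < x ^ (1 - b - 1) := Real.rpow_pos_of_pos hx0 _
    rw [h3]
    have h5 : (1 - b) * h x + x * deriv h x ≤ 0 := by nlinarith
    nlinarith
  have e1 : ∀ x : ℝ, 0 < x → x * h x = x ^ b * (x ^ (1 - b) * h x) := by
    intro x hx
    rw [← mul_assoc, ← Real.rpow_add hx]; simp
  rw [e1 _ hr, e1 _ (by linarith : 0 < 2 * r), Real.mul_rpow (z := b) (by norm_num) hr.le,
    mul_assoc]
  have h6 : 0 < r ^ b := Real.rpow_pos_of_pos hr _
  have h7 : (0 : ℝ) < 2 ^ b := Real.rpow_pos_of_pos (by norm_num) _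
  refine mul_le_mul_of_nonneg_left (mul_le_mul_of_nonneg_left ?_ h6.le) h7.le
  linarith

theorem prim_mono (h : ℝ → ℝ) {r R : ℝ} (hrR : r ≤ R) : prim h r ≤ prim h R :=
  lintegral_mono_set (Ioc_subset_Ioc_right hrR)

theorem prim_mul (h : ℝ → ℝ) {c : ℝ} (hc : 0 < c) (r : ℝ) :
    prim h (c * r) = ENNReal.ofReal c * ∫⁻ ρ in Ioc 0 r, ENNReal.ofReal ((c * ρ) * h (c * ρ)) := by
  unfold prim
  rw [← lintegral_indicator measurableSet_Ioc, ← lintegral_indicator measurableSet_Ioc]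
  have hm := Real.smul_map_volume_mul_left hc.ne'
  rw [abs_of_pos hc] at hm
  have he : MeasurableEmbedding (fun x : ℝ => c * x) :=
    (Homeomorph.mulLeft₀ c hc.ne').measurableEmbedding
  conv_lhs => rw [← hm]
  rw [lintegral_smul_measure, he.lintegral_map, smul_eq_mul]
  congr 2
  ext ρ
  simp only [indicator, mem_Ioc]
  have : (0 < c * ρ ∧ c * ρ ≤ c * r) ↔ (0 < ρ ∧ ρ ≤ r) := by
    rw [mul_le_mul_iff_right₀ hc, mul_pos_iff_of_pos_left hc]
  simp only [this]

/-- The doubling constant. -/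
noncomputable def dbl (b : ℝ) : ℝ≥0∞ := 2 * ENNReal.ofReal (2 ^ b)

theorem dbl_lt_top (b : ℝ) : dbl b < ⊤ := by
  unfold dbl; exact ENNReal.mul_lt_top (by simp) (by simp)

theorem IsProfile.prim_double {a b : ℝ} {h : ℝ → ℝ} (H : IsProfile a b h) (r : ℝ) :
    prim h (2 * r) ≤ dbl b * prim h r := by
  rw [prim_mul h (by norm_num : (0 : ℝ) < 2), dbl, mul_assoc]
  have : ENNReal.ofReal 2 = 2 := by simp
  rw [this]
  gcongr
  unfold prim
  rw [← lintegral_const_mul' _ _ (by simp)]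
  refine setLIntegral_mono' measurableSet_Ioc fun ρ hρ => ?_
  rw [← ENNReal.ofReal_mul (by positivity)]
  exact ENNReal.ofReal_le_ofReal (H.double hρ.1)

theorem IsProfile.prim_small {a b : ℝ} {h : ℝ → ℝ} (ha : 0 < a) (H : IsProfile a b h)
    {ε : ℝ} (hε : 0 < ε) (hε1 : ε ≤ 1) (r : ℝ) :
    prim h (ε * r) ≤ ENNReal.ofReal ε * prim h r := by
  rw [prim_mul h hε]
  gcongr
  refine setLIntegral_mono' measurableSet_Ioc fun ρ hρ => ?_
  refine ENNReal.ofReal_le_ofReal (H.mono ha (mul_pos hε hρ.1) ?_)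
  nlinarith [hρ.1]

theorem IsProfile.young {a b : ℝ} {h : ℝ → ℝ} (ha : 0 < a) (H : IsProfile a b h)
    {r t : ℝ} (hr : 0 ≤ r) (ht : 0 ≤ t) :
    ENNReal.ofReal (r * h r * t) ≤ dbl b * (prim h r + prim h t) := by
  have key : ∀ x : ℝ, 0 < x → ENNReal.ofReal (x * h x * x) ≤ dbl b * prim h x := by
    intro x hx
    refine le_trans ?_ (H.prim_double x)
    calc ENNReal.ofReal (x * h x * x)
        = ∫⁻ _ in Ioc x (2 * x), ENNReal.ofReal (x * h x) := by
          rw [setLIntegral_const, Real.volume_Ioc, ← ENNReal.ofReal_mul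
            (mul_pos hx (H.pos x hx)).le]
          congr 2; ring
      _ ≤ ∫⁻ ρ in Ioc x (2 * x), ENNReal.ofReal (ρ * h ρ) :=
          setLIntegral_mono' measurableSet_Ioc fun ρ hρ =>
            ENNReal.ofReal_le_ofReal (H.mono ha hx hρ.1.le)
      _ ≤ prim h (2 * x) := lintegral_mono_set (Ioc_subset_Ioc_left hx.le)
  rcases hr.eq_or_lt with rfl | hr
  · simp
  rcases ht.eq_or_lt with rfl | ht
  · simp
  rcases le_total r t with hrt | hrt
  · refine le_trans (ENNReal.ofReal_le_ofReal ?_) ((key t ht).trans ?_)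
    · have := H.mono ha hr hrt
      gcongr
    · gcongr; exact le_add_self
  · refine le_trans (ENNReal.ofReal_le_ofReal ?_) ((key r hr).trans ?_)
    · have := mul_pos hr (H.pos r hr)
      gcongr
    · gcongr; exact le_self_add

theorem IsProfile.prim_add {a b : ℝ} {h : ℝ → ℝ} (H : IsProfile a b h) (x y : ℝ) :
    prim h |x + y| ≤ dbl b * (prim h |x| + prim h |y|) := by
  rcases le_total |x| |y| with hxy | hxy
  · refine (prim_mono h (R := 2 * |y|) ?_).trans ((H.prim_double _).trans ?_)
    · linarith [abs_add_le x y]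
    · gcongr; exact le_add_self
  · refine (prim_mono h (R := 2 * |x|) ?_).trans ((H.prim_double _).trans ?_)
    · linarith [abs_add_le x y]
    · gcongr; exact le_self_add

/-! ### Modulars and Luxemburg norms over a measure space -/

/-- The modular `∫ H(p, |f p|) dμ(p)`, where `H(p, ·) = prim (h p)`. -/
noncomputable def modular {α : Type*} [MeasurableSpace α] (h : α → ℝ → ℝ) (μ : Measure α)
    (f : α → ℝ) : ℝ≥0∞ := ∫⁻ p, prim (h p) |f p| ∂μ

/-- The Luxemburg norm `inf {lam > 0 : modular (f / lam) ≤ 1}`. -/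
noncomputable def luxNorm {α : Type*} [MeasurableSpace α] (h : α → ℝ → ℝ) (μ : Measure α)
    (f : α → ℝ) : ℝ := sInf {lam : ℝ | 0 < lam ∧ modular h μ (fun p => f p / lam) ≤ 1}

section Modular

variable {α : Type*} [MeasurableSpace α] {h : α → ℝ → ℝ} {μ : Measure α} {a b : ℝ}

theorem measurable_prim (hm : Measurable fun q : α × ℝ => h q.1 q.2) :
    Measurable fun q : α × ℝ => prim (h q.1) q.2 := by
  have e : (fun q : α × ℝ => prim (h q.1) q.2) = fun q : α × ℝ =>
      ∫⁻ ρ, {z : (α × ℝ) × ℝ | 0 < z.2 ∧ z.2 ≤ z.1.2}.indicator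
        (fun z => ENNReal.ofReal (z.2 * h z.1.1 z.2)) (q, ρ) := by
    ext q
    unfold prim
    rw [← lintegral_indicator measurableSet_Ioc]
    rfl
  rw [e]
  apply Measurable.lintegral_prod_right'
    (f := {z : (α × ℝ) × ℝ | 0 < z.2 ∧ z.2 ≤ z.1.2}.indicator
        (fun z => ENNReal.ofReal (z.2 * h z.1.1 z.2)))
  apply Measurable.indicator
  · have : Measurable fun z : (α × ℝ) × ℝ => h z.1.1 z.2 :=
      hm.comp (by fun_prop : Measurable fun z : (α × ℝ) × ℝ => (z.1.1, z.2))
    fun_prop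
  · have m1 : MeasurableSet {z : (α × ℝ) × ℝ | 0 < z.2} :=
      measurableSet_lt measurable_const measurable_snd
    have m2 : MeasurableSet {z : (α × ℝ) × ℝ | z.2 ≤ z.1.2} :=
      measurableSet_le measurable_snd (measurable_snd.comp measurable_fst)
    exact m1.inter m2

theorem aemeasurable_prim (hm : Measurable fun q : α × ℝ => h q.1 q.2) {f : α → ℝ}
    (hf : AEMeasurable f μ) : AEMeasurable (fun p => prim (h p) |f p|) μ :=
  (measurable_prim hm).comp_aemeasurable
    (g := fun q : α × ℝ => prim (h q.1) q.2) (aemeasurable_id.prodMk hf.abs)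

theorem modular_zero : modular h μ (0 : α → ℝ) = 0 := by
  simp [modular, prim]

theorem modular_add (hm : Measurable fun q : α × ℝ => h q.1 q.2)
    (H : ∀ᵐ p ∂μ, IsProfile a b (h p)) {f k : α → ℝ} (hf : AEMeasurable f μ) :
    modular h μ (f + k) ≤ dbl b * (modular h μ f + modular h μ k) := by
  unfold modular
  rw [← lintegral_add_left' (aemeasurable_prim hm hf), ← lintegral_const_mul' _ _ (dbl_lt_top b).ne]
  refine lintegral_mono_ae ?_
  filter_upwards [H] with p hp
  exact hp.prim_add _ _

theorem modular_two_pow (H : ∀ᵐ p ∂μ, IsProfile a b (h p)) (n : ℕ) {f : α → ℝ}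
    (hfin : modular h μ f < ⊤) : modular h μ (fun p => 2 ^ n * f p) < ⊤ := by
  induction n with
  | zero => simpa using hfin
  | succ n ih =>
    refine lt_of_le_of_lt ?_ (ENNReal.mul_lt_top (dbl_lt_top b) ih)
    unfold modular
    rw [← lintegral_const_mul' _ _ (dbl_lt_top b).ne]
    refine lintegral_mono_ae ?_
    filter_upwards [H] with p hp
    rw [show (2 : ℝ) ^ (n + 1) * f p = 2 * (2 ^ n * f p) by ring, abs_mul, abs_two]
    exact hp.prim_double _

theorem modular_smul (H : ∀ᵐ p ∂μ, IsProfile a b (h p)) (c : ℝ) {f : α → ℝ}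
    (hfin : modular h μ f < ⊤) : modular h μ (c • f) < ⊤ := by
  obtain ⟨n, hn⟩ := pow_unbounded_of_one_lt |c| (one_lt_two : (1 : ℝ) < 2)
  refine lt_of_le_of_lt ?_ (modular_two_pow H n hfin)
  refine lintegral_mono fun p => prim_mono _ ?_
  simp only [Pi.smul_apply, smul_eq_mul, abs_mul, abs_pow, abs_two]
  gcongr

theorem luxNorm_nonneg (f : α → ℝ) : 0 ≤ luxNorm h μ f :=
  Real.sInf_nonneg fun _ hx => hx.1.le

theorem luxNorm_le {f : α → ℝ} {lam : ℝ} (h0 : 0 < lam)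
    (h1 : modular h μ (fun p => f p / lam) ≤ 1) : luxNorm h μ f ≤ lam :=
  csInf_le ⟨0, fun _ hx => hx.1.le⟩ ⟨h0, h1⟩

theorem modular_div_le (ha : 0 < a) (H : ∀ᵐ p ∂μ, IsProfile a b (h p)) (f : α → ℝ)
    {lam : ℝ} (h1 : 1 ≤ lam) :
    modular h μ (fun p => f p / lam) ≤ ENNReal.ofReal lam⁻¹ * modular h μ f := by
  unfold modular
  rw [← lintegral_const_mul' _ _ ENNReal.ofReal_ne_top]
  refine lintegral_mono_ae ?_
  filter_upwards [H] with p hp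
  have h0 : 0 < lam := by linarith
  rw [abs_div, abs_of_pos h0, div_eq_inv_mul]
  exact hp.prim_small ha (by positivity) (inv_le_one_of_one_le₀ h1) _

theorem exists_modular_le_one (ha : 0 < a) (H : ∀ᵐ p ∂μ, IsProfile a b (h p)) {f : α → ℝ}
    (hfin : modular h μ f < ⊤) :
    {lam : ℝ | 0 < lam ∧ modular h μ (fun p => f p / lam) ≤ 1}.Nonempty := by
  set M := (modular h μ f).toReal with hM
  have hM0 : 0 ≤ M := ENNReal.toReal_nonneg
  refine ⟨M + 1, by positivity, (modular_div_le ha H f (by linarith)).trans ?_⟩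
  rw [← ENNReal.ofReal_toReal hfin.ne, ← ENNReal.ofReal_mul (by positivity), ← hM]
  apply ENNReal.ofReal_le_one.2
  rw [inv_mul_le_iff₀ (by positivity)]
  linarith

theorem exists_lt_of_luxNorm_lt (ha : 0 < a) (H : ∀ᵐ p ∂μ, IsProfile a b (h p)) {f : α → ℝ}
    (hfin : modular h μ f < ⊤) {ε : ℝ} (hε : luxNorm h μ f < ε) :
    ∃ lam, 0 < lam ∧ lam < ε ∧ modular h μ (fun p => f p / lam) ≤ 1 := by
  obtain ⟨l, ⟨h0, h1⟩, h2⟩ := exists_lt_of_csInf_lt (exists_modular_le_one ha H hfin) hε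
  exact ⟨l, h0, h2, h1⟩

theorem luxNorm_add_le (ha : 0 < a) (hm : Measurable fun q : α × ℝ => h q.1 q.2)
    (H : ∀ᵐ p ∂μ, IsProfile a b (h p)) {f k : α → ℝ} (hf : AEMeasurable f μ)
    (hfin : modular h μ f < ⊤) (hkin : modular h μ k < ⊤) {ε : ℝ}
    (h1 : luxNorm h μ f < ε) (h2 : luxNorm h μ k < ε) : luxNorm h μ (f + k) ≤ 4 * ε := by
  obtain ⟨l, l0, l1, l2⟩ := exists_lt_of_luxNorm_lt ha H hfin h1
  obtain ⟨m, m0, m1, m2⟩ := exists_lt_of_luxNorm_lt ha H hkin h2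
  have hε : 0 < ε := l0.trans l1
  refine luxNorm_le (by positivity) ?_
  have main : modular h μ (fun p => (f + k) p / (4 * ε)) ≤
      ENNReal.ofReal (1 / 2) * (modular h μ (fun p => f p / l) + modular h μ (fun p => k p / m)) := by
    unfold modular
    rw [← lintegral_add_left' (aemeasurable_prim hm (hf.div_const l)),
      ← lintegral_const_mul' _ _ ENNReal.ofReal_ne_top]
    refine lintegral_mono_ae ?_
    filter_upwards [H] with p hp
    have e : |(f + k) p / (4 * ε)| ≤ max (1 / 2 * |f p / l|) (1 / 2 * |k p / m|) := by
      have hf' : |f p| / ε ≤ |f p / l| := by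
        rw [abs_div, abs_of_pos l0]; gcongr
      have hk' : |k p| / ε ≤ |k p / m| := by
        rw [abs_div, abs_of_pos m0]; gcongr
      have h3 : |(f + k) p / (4 * ε)| ≤ 1 / 4 * (|f p| / ε) + 1 / 4 * (|k p| / ε) := by
        rw [abs_div, abs_of_pos (by positivity : 0 < 4 * ε), Pi.add_apply]
        have := abs_add_le (f p) (k p)
        calc _ ≤ (|f p| + |k p|) / (4 * ε) := by gcongr
          _ = _ := by field_simp
      rcases le_total |f p / l| |k p / m| with h4 | h4
      · exact le_max_of_le_right (by linarith)
      · exact le_max_of_le_left (by linarith)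
    refine (prim_mono _ e).trans ?_
    rcases max_choice (1 / 2 * |f p / l|) (1 / 2 * |k p / m|) with h5 | h5
    · rw [h5]
      refine (hp.prim_small ha (by norm_num) (by norm_num) _).trans ?_
      gcongr; exact le_self_add
    · rw [h5]
      refine (hp.prim_small ha (by norm_num) (by norm_num) _).trans ?_
      gcongr; exact le_add_self
  refine main.trans ((mul_le_mul_right (add_le_add l2 m2) _).trans (le_of_eq ?_))
  rw [show (1 : ℝ≥0∞) + 1 = ENNReal.ofReal 2 by norm_num, ← ENNReal.ofReal_mul (by norm_num)]
  norm_num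

theorem luxNorm_smul_le (ha : 0 < a) (H : ∀ᵐ p ∂μ, IsProfile a b (h p)) {f : α → ℝ}
    (hfin : modular h μ f < ⊤) (c : ℝ) {ε : ℝ} (h1 : luxNorm h μ f < ε) :
    luxNorm h μ (c • f) ≤ (|c| + 1) * ε := by
  obtain ⟨l, l0, l1, l2⟩ := exists_lt_of_luxNorm_lt ha H hfin h1
  have hε : 0 < ε := l0.trans l1
  refine luxNorm_le (by positivity) (le_trans ?_ l2)
  refine lintegral_mono fun p => prim_mono _ ?_
  simp only [Pi.smul_apply, smul_eq_mul]
  rw [abs_div, abs_div, abs_mul, abs_of_pos l0, abs_of_pos (by positivity : 0 < (|c| + 1) * ε)]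
  calc |c| * |f p| / ((|c| + 1) * ε) ≤ (|c| + 1) * |f p| / ((|c| + 1) * ε) := by
        gcongr; linarith
    _ = |f p| / ε := by field_simp
    _ ≤ |f p| / l := by gcongr

end Modular

/-! ### The nonlinearity, the spaces `W^{s,G}(ℝ^d)` and `W₀^{s,G}(Ω)` -/

/-- `ℝ^d` with its Euclidean norm. -/
abbrev Space (d : ℕ) := EuclideanSpace ℝ (Fin d)

/-- An admissible nonlinearity `g(x,y,r)` with growth constants `0 < g_* ≤ g^*`. The conditions in
`r` hold for almost every `(x,y)`; since `Ĝ(x,r) = G(x,x,r)` restricts `g` to the diagonal (a null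
set), they are also required at `(x,x)` for almost every `x`. Only `r > 0` matters. -/
structure Nonlinearity (d : ℕ) where
  g : Space d → Space d → ℝ → ℝ
  lower : ℝ
  upper : ℝ
  lower_pos : 0 < lower
  lower_le_upper : lower ≤ upper
  measurable_g : Measurable fun q : (Space d × Space d) × ℝ => g q.1.1 q.1.2 q.2
  profile : ∀ᵐ p : Space d × Space d, IsProfile lower upper (g p.1 p.2)
  profile_diag : ∀ᵐ x : Space d, IsProfile lower upper (g x x)

/-- The measure `dx dy / |x - y|^d` on `ℝ^d × ℝ^d`. -/
noncomputable def pairMeasure (d : ℕ) : Measure (Space d × Space d) :=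
  (volume : Measure (Space d × Space d)).withDensity
    fun p => ENNReal.ofReal (‖p.1 - p.2‖ ^ d)⁻¹

/-- The finite difference quotient `δˢu(x,y) = (u(x) - u(y)) / |x - y|^s`. -/
noncomputable def quot {d : ℕ} (s : ℝ) (u : Space d → ℝ) (p : Space d × Space d) : ℝ :=
  (u p.1 - u p.2) / ‖p.1 - p.2‖ ^ s

section Spaces

variable {d : ℕ}

/-- `g` on the diagonal, whose primitive is `Ĝ(x,r) = G(x,x,r)`. -/
def Nonlinearity.diag (N : Nonlinearity d) (x : Space d) : ℝ → ℝ := N.g x x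

/-- `g` as a function of the pair `p = (x,y)`, whose primitive is `G(x,y,r)`. -/
def Nonlinearity.pair (N : Nonlinearity d) (p : Space d × Space d) : ℝ → ℝ := N.g p.1 p.2

theorem Nonlinearity.measurable_diag (N : Nonlinearity d) :
    Measurable fun q : Space d × ℝ => N.diag q.1 q.2 :=
  N.measurable_g.comp (by fun_prop : Measurable fun q : Space d × ℝ => ((q.1, q.1), q.2))

theorem Nonlinearity.measurable_pair (N : Nonlinearity d) :
    Measurable fun q : (Space d × Space d) × ℝ => N.pair q.1 q.2 := N.measurable_g

theorem Nonlinearity.profile_pair (N : Nonlinearity d) :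
    ∀ᵐ p ∂(pairMeasure d), IsProfile N.lower N.upper (N.pair p) :=
  (withDensity_absolutelyContinuous _ _).ae_le N.profile

theorem quot_add (s : ℝ) (u v : Space d → ℝ) : quot s (u + v) = quot s u + quot s v := by
  ext p; simp only [quot, Pi.add_apply]; ring

theorem quot_smul (s c : ℝ) (u : Space d → ℝ) : quot s (c • u) = c • quot s u := by
  ext p; simp only [quot, Pi.smul_apply, smul_eq_mul]; ring

theorem aemeasurable_quot (s : ℝ) {u : Space d → ℝ} (hu : AEMeasurable u) :
    AEMeasurable (quot s u) (pairMeasure d) := by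
  have h : AEMeasurable (quot s u) (volume : Measure (Space d × Space d)) := by
    have h1 : AEMeasurable (fun p : Space d × Space d => u p.1) volume :=
      hu.comp_quasiMeasurePreserving Measure.quasiMeasurePreserving_fst
    have h2 : AEMeasurable (fun p : Space d × Space d => u p.2) volume :=
      hu.comp_quasiMeasurePreserving Measure.quasiMeasurePreserving_snd
    have h3 : AEMeasurable (fun p : Space d × Space d => ‖p.1 - p.2‖ ^ s) volume := by fun_prop
    exact (h1.sub h2).div h3
  exact h.mono_ac (withDensity_absolutelyContinuous _ _)

/-- `W^{s,G}(ℝ^d)`: the measurable functions `u` with `∫ G(x,x,|u(x)|) dx < ∞` and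
`∬ G(x,y,|δˢu(x,y)|) dx dy / |x-y|^d < ∞`. Functions that agree a.e. are not identified in this
type; every notion below is invariant under a.e. equality. -/
noncomputable def W (N : Nonlinearity d) (s : ℝ) : Submodule ℝ (Space d → ℝ) where
  carrier := {u | AEMeasurable u ∧ modular N.diag volume u < ⊤ ∧
    modular N.pair (pairMeasure d) (quot s u) < ⊤}
  zero_mem' := by
    refine ⟨aemeasurable_const, ?_, ?_⟩
    · rw [modular_zero]; simp
    · have : quot s (0 : Space d → ℝ) = 0 := by ext p; simp [quot]
      rw [this, modular_zero]; simp
  add_mem' := by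
    rintro u v ⟨hu, hu1, hu2⟩ ⟨hv, hv1, hv2⟩
    refine ⟨hu.add hv, ?_, ?_⟩
    · exact (modular_add N.measurable_diag N.profile_diag hu).trans_lt
        (ENNReal.mul_lt_top (dbl_lt_top _) (ENNReal.add_lt_top.2 ⟨hu1, hv1⟩))
    · rw [quot_add]
      exact (modular_add N.measurable_pair N.profile_pair (aemeasurable_quot s hu)).trans_lt
        (ENNReal.mul_lt_top (dbl_lt_top _) (ENNReal.add_lt_top.2 ⟨hu2, hv2⟩))
  smul_mem' := by
    rintro c u ⟨hu, hu1, hu2⟩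
    refine ⟨hu.const_smul c, modular_smul N.profile_diag c hu1, ?_⟩
    rw [quot_smul]
    exact modular_smul N.profile_pair c hu2

/-- The norm `‖u‖_{s,G} = ‖u‖_G + [u]_{s,G}`, the sum of the two Luxemburg norms. -/
noncomputable def normW (N : Nonlinearity d) (s : ℝ) (u : Space d → ℝ) : ℝ :=
  luxNorm N.diag volume u + luxNorm N.pair (pairMeasure d) (quot s u)

theorem normW_add_le {N : Nonlinearity d} {s : ℝ} {u v : Space d → ℝ} (hu : u ∈ W N s)
    (hv : v ∈ W N s) {ε : ℝ} (h1 : normW N s u < ε) (h2 : normW N s v < ε) :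
    normW N s (u + v) ≤ 8 * ε := by
  unfold normW at h1 h2 ⊢
  have a1 := luxNorm_nonneg (h := N.diag) (μ := volume) u
  have a2 := luxNorm_nonneg (h := N.diag) (μ := volume) v
  have a3 := luxNorm_nonneg (h := N.pair) (μ := pairMeasure d) (quot s u)
  have a4 := luxNorm_nonneg (h := N.pair) (μ := pairMeasure d) (quot s v)
  have b1 := luxNorm_add_le (ε := ε) N.lower_pos N.measurable_diag N.profile_diag hu.1 hu.2.1
    hv.2.1 (by linarith) (by linarith)
  have b2 := luxNorm_add_le (ε := ε) N.lower_pos N.measurable_pair N.profile_pair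
    (aemeasurable_quot s hu.1) hu.2.2 hv.2.2 (by linarith) (by linarith)
  rw [quot_add]
  linarith

theorem normW_smul_le {N : Nonlinearity d} {s : ℝ} {u : Space d → ℝ} (hu : u ∈ W N s) (c : ℝ)
    {ε : ℝ} (h1 : normW N s u < ε) : normW N s (c • u) ≤ 2 * (|c| + 1) * ε := by
  unfold normW at h1 ⊢
  have a1 := luxNorm_nonneg (h := N.diag) (μ := volume) u
  have a3 := luxNorm_nonneg (h := N.pair) (μ := pairMeasure d) (quot s u)
  have b1 := luxNorm_smul_le (h := N.diag) (ε := ε) N.lower_pos N.profile_diag hu.2.1 c (by linarith)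
  have b2 := luxNorm_smul_le (ε := ε) N.lower_pos N.profile_pair hu.2.2 c (by linarith)
  rw [quot_smul]
  linarith

theorem normW_zero (N : Nonlinearity d) (s : ℝ) : normW N s 0 = 0 := by
  have key : ∀ {α : Type} [MeasurableSpace α] (h : α → ℝ → ℝ) (μ : Measure α),
      luxNorm h μ (0 : α → ℝ) = 0 := by
    intro α _ h μ
    refine le_antisymm (le_of_forall_pos_le_add fun ε hε => ?_) (luxNorm_nonneg _)
    rw [zero_add]
    refine luxNorm_le hε ?_
    have : (fun p => (0 : α → ℝ) p / ε) = 0 := by ext; simp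
    rw [this, modular_zero]; simp
  have : quot s (0 : Space d → ℝ) = 0 := by ext p; simp [quot]
  rw [normW, this, key, key, add_zero]

/-- `C_c^∞(Ω)`: smooth functions on `ℝ^d` with compact support contained in `Ω`. -/
def IsTest (Ω : Set (Space d)) (f : Space d → ℝ) : Prop :=
  ContDiff ℝ ∞ f ∧ HasCompactSupport f ∧ tsupport f ⊆ Ω

theorem IsTest.add {Ω : Set (Space d)} {f k : Space d → ℝ} (hf : IsTest Ω f) (hk : IsTest Ω k) :
    IsTest Ω (f + k) :=
  ⟨hf.1.add hk.1, hf.2.1.add hk.2.1,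
    (tsupport_add f k).trans (union_subset hf.2.2 hk.2.2)⟩

theorem IsTest.smul {Ω : Set (Space d)} {f : Space d → ℝ} (hf : IsTest Ω f) (c : ℝ) :
    IsTest Ω (c • f) := by
  have hs : tsupport (c • f) ⊆ tsupport f := closure_mono (Function.support_const_smul_subset c f)
  exact ⟨hf.1.const_smul c, hf.2.1.of_isClosed_subset (isClosed_tsupport _) hs, hs.trans hf.2.2⟩

/-- `W₀^{s,G}(Ω)`: the closure of `C_c^∞(Ω)` in `W^{s,G}(ℝ^d)` for the norm `‖·‖_{s,G}`. -/
noncomputable def W₀ (N : Nonlinearity d) (s : ℝ) (Ω : Set (Space d)) :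
    Submodule ℝ (Space d → ℝ) where
  carrier := {u | u ∈ W N s ∧ ∀ ε > 0, ∃ f, IsTest Ω f ∧ f ∈ W N s ∧ normW N s (u - f) < ε}
  zero_mem' := by
    refine ⟨zero_mem _, fun ε hε => ⟨0, ⟨contDiff_const, HasCompactSupport.zero, ?_⟩,
      zero_mem _, ?_⟩⟩
    · simp [tsupport]
    · rw [sub_zero, normW_zero]; exact hε
  add_mem' := by
    rintro u v ⟨hu, hu'⟩ ⟨hv, hv'⟩
    refine ⟨add_mem hu hv, fun ε hε => ?_⟩
    obtain ⟨f, hf, hfW, hf'⟩ := hu' (ε / 16) (by positivity)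
    obtain ⟨k, hk, hkW, hk'⟩ := hv' (ε / 16) (by positivity)
    refine ⟨f + k, hf.add hk, add_mem hfW hkW, ?_⟩
    have := normW_add_le (sub_mem hu hfW) (sub_mem hv hkW) hf' hk'
    rw [add_sub_add_comm]
    linarith
  smul_mem' := by
    rintro c u ⟨hu, hu'⟩
    refine ⟨Submodule.smul_mem _ c hu, fun ε hε => ?_⟩
    have hc : 0 < |c| + 1 := by positivity
    obtain ⟨f, hf, hfW, hf'⟩ := hu' (ε / (4 * (|c| + 1))) (by positivity)
    refine ⟨c • f, hf.smul c, Submodule.smul_mem _ c hfW, ?_⟩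
    have := normW_smul_le (sub_mem hu hfW) c hf'
    rw [← smul_sub]
    refine this.trans_lt ?_
    field_simp
    linarith

theorem W₀_le_W (N : Nonlinearity d) (s : ℝ) (Ω : Set (Space d)) : W₀ N s Ω ≤ W N s :=
  fun _ hu => hu.1

/-- An element of `W₀^{s,G}(Ω)` regarded as an element of `W^{s,G}(ℝ^d)`. -/
noncomputable def toW {N : Nonlinearity d} {s : ℝ} {Ω : Set (Space d)} (u : W₀ N s Ω) : W N s :=
  Submodule.inclusion (W₀_le_W N s Ω) u

/-! ### The dual space, its order, and the order dual -/

/-- `W^{-s,G*}(Ω)`: the linear functionals on `W₀^{s,G}(Ω)` bounded with respect to `‖·‖_{s,G}`. -/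
noncomputable def Dual (N : Nonlinearity d) (s : ℝ) (Ω : Set (Space d)) :
    Submodule ℝ (Module.Dual ℝ (W₀ N s Ω)) where
  carrier := {F | ∃ C : ℝ, ∀ v : W₀ N s Ω, |F v| ≤ C * normW N s v}
  zero_mem' := ⟨0, fun v => by simp⟩
  add_mem' := by
    rintro F F' ⟨C, hC⟩ ⟨C', hC'⟩
    refine ⟨C + C', fun v => ?_⟩
    rw [LinearMap.add_apply]
    linarith [abs_add_le (F v) (F' v), hC v, hC' v]
  smul_mem' := by
    rintro c F ⟨C, hC⟩
    refine ⟨|c| * C, fun v => ?_⟩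
    rw [LinearMap.smul_apply, smul_eq_mul, abs_mul, mul_assoc]
    exact mul_le_mul_of_nonneg_left (hC v) (abs_nonneg c)

/-- The duality pairing `⟨F, v⟩`. -/
noncomputable def pairing {N : Nonlinearity d} {s : ℝ} {Ω : Set (Space d)} (F : Dual N s Ω)
    (v : W₀ N s Ω) : ℝ := (F : Module.Dual ℝ (W₀ N s Ω)) v

/-- The order of `W^{-s,G*}(Ω)`: `F ≤ F'` iff `⟨F, v⟩ ≤ ⟨F', v⟩` for all `v ∈ W₀^{s,G}(Ω)` with
`v ≥ 0` a.e. -/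
noncomputable instance dualPreorder (N : Nonlinearity d) (s : ℝ) (Ω : Set (Space d)) :
    Preorder (Dual N s Ω) where
  le F F' := ∀ v : W₀ N s Ω, (0 : Space d → ℝ) ≤ᵐ[volume] v → pairing F v ≤ pairing F' v
  le_refl _ _ _ := le_rfl
  le_trans _ _ _ h h' v hv := (h v hv).trans (h' v hv)

/-- The order dual `W_≺^{-s,G*}(Ω)`: differences of positive elements of `W^{-s,G*}(Ω)`. -/
def orderDual (N : Nonlinearity d) (s : ℝ) (Ω : Set (Space d)) : Set (Dual N s Ω) :=
  {F | ∃ A B : Dual N s Ω, 0 ≤ A ∧ 0 ≤ B ∧ F = A - B}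

/-- `F⁺ ∈ W_≺^{-s,G*}(Ω)`: the positive part `F⁺ = F ∨ 0` exists in the ordered space
`W^{-s,G*}(Ω)` and belongs to the order dual. -/
def PosPartMemOrderDual {N : Nonlinearity d} {s : ℝ} {Ω : Set (Space d)} (F : Dual N s Ω) : Prop :=
  ∃ P ∈ orderDual N s Ω, IsLUB {F, 0} P

/-! ### The operator -/

/-- `∬ g(x,y,|δˢu|) δˢu δˢv dx dy / |x-y|^d`. -/
noncomputable def form (N : Nonlinearity d) (s : ℝ) (u v : Space d → ℝ) : ℝ :=
  ∫ p, N.g p.1 p.2 |quot s u p| * quot s u p * quot s v p ∂(pairMeasure d)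

theorem aestronglyMeasurable_form (N : Nonlinearity d) (s : ℝ) {u v : Space d → ℝ}
    (hu : AEMeasurable u) (hv : AEMeasurable v) :
    AEStronglyMeasurable (fun p => N.g p.1 p.2 |quot s u p| * quot s u p * quot s v p)
      (pairMeasure d) := by
  have h1 := aemeasurable_quot s hu
  have h2 := aemeasurable_quot s hv
  have h3 : AEMeasurable (fun p => N.g p.1 p.2 |quot s u p|) (pairMeasure d) :=
    N.measurable_g.comp_aemeasurable (aemeasurable_id.prodMk h1.abs)
  exact ((h3.mul h1).mul h2).aestronglyMeasurable

theorem enorm_form_le {N : Nonlinearity d} {s : ℝ} {u : Space d → ℝ} (f : Space d × Space d → ℝ)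
    (hu : AEMeasurable u) :
    ∫⁻ p, ‖N.g p.1 p.2 |quot s u p| * quot s u p * f p‖ₑ ∂(pairMeasure d) ≤
      dbl N.upper * (modular N.pair (pairMeasure d) (quot s u) +
        modular N.pair (pairMeasure d) f) := by
  unfold modular
  rw [← lintegral_add_left' (aemeasurable_prim N.measurable_pair (aemeasurable_quot s hu)),
    ← lintegral_const_mul' _ _ (dbl_lt_top _).ne]
  refine lintegral_mono_ae ?_
  filter_upwards [N.profile_pair] with p hp
  refine le_trans (le_of_eq ?_) (hp.young N.lower_pos (abs_nonneg (quot s u p)) (abs_nonneg (f p)))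
  rw [Real.enorm_eq_ofReal_abs, abs_mul, abs_mul]
  rcases (abs_nonneg (quot s u p)).eq_or_lt with h0 | h0
  · simp [← h0]
  · have := hp.pos _ h0
    rw [Nonlinearity.pair] at this ⊢
    rw [abs_of_pos this, mul_comm |quot s u p|]

theorem integrable_form {N : Nonlinearity d} {s : ℝ} {u v : Space d → ℝ} (hu : u ∈ W N s)
    (hv : v ∈ W N s) :
    Integrable (fun p => N.g p.1 p.2 |quot s u p| * quot s u p * quot s v p) (pairMeasure d) :=
  ⟨aestronglyMeasurable_form N s hu.1 hv.1, (enorm_form_le (quot s v) hu.1).trans_lt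
    (ENNReal.mul_lt_top (dbl_lt_top _) (ENNReal.add_lt_top.2 ⟨hu.2.2, hv.2.2⟩))⟩

theorem abs_form_le {N : Nonlinearity d} {s : ℝ} {u v : Space d → ℝ} (hu : u ∈ W N s)
    (hv : v ∈ W N s) : |form N s u v| ≤
      ((dbl N.upper * (modular N.pair (pairMeasure d) (quot s u) + 1)).toReal + 1) *
        luxNorm N.pair (pairMeasure d) (quot s v) := by
  set C := (dbl N.upper * (modular N.pair (pairMeasure d) (quot s u) + 1)).toReal with hC
  have hC0 : 0 ≤ C := ENNReal.toReal_nonneg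
  have hfin : dbl N.upper * (modular N.pair (pairMeasure d) (quot s u) + 1) < ⊤ :=
    ENNReal.mul_lt_top (dbl_lt_top _) (ENNReal.add_lt_top.2 ⟨hu.2.2, by simp⟩)
  rw [← div_le_iff₀' (by positivity)]
  refine le_csInf (exists_modular_le_one N.lower_pos N.profile_pair hv.2.2) ?_
  rintro lam ⟨h0, h1⟩
  rw [div_le_iff₀' (by positivity)]
  have e : form N s u v = lam * ∫ p, N.g p.1 p.2 |quot s u p| * quot s u p * (quot s v p / lam)
      ∂(pairMeasure d) := by
    rw [form, ← integral_const_mul]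
    refine integral_congr_ae (Eventually.of_forall fun p => ?_)
    dsimp only
    field_simp
  have key : |∫ p, N.g p.1 p.2 |quot s u p| * quot s u p * (quot s v p / lam)
      ∂(pairMeasure d)| ≤ C := by
    rw [← Real.norm_eq_abs, hC, ← toReal_enorm]
    refine ENNReal.toReal_mono hfin.ne ((enorm_integral_le_lintegral_enorm _).trans ?_)
    refine (enorm_form_le (fun p => quot s v p / lam) hu.1).trans ?_
    gcongr
  rw [e, abs_mul, abs_of_pos h0]
  nlinarith

/-- The operator `𝓛_g^s : W^{s,G}(ℝ^d) → W^{-s,G*}(Ω)`,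
`⟨𝓛_g^s u, v⟩ = ∬ g(x,y,|δˢu|) δˢu δˢv dx dy / |x-y|^d` for `v ∈ W₀^{s,G}(Ω)`. -/
noncomputable def Lg {N : Nonlinearity d} {s : ℝ} (Ω : Set (Space d)) (u : W N s) : Dual N s Ω :=
  ⟨{ toFun := fun v => form N s u v
     map_add' := by
      intro v w
      rw [form, form, form, ← integral_add (integrable_form u.2 v.2.1)
        (integrable_form u.2 w.2.1), Submodule.coe_add, quot_add]
      refine integral_congr_ae (Eventually.of_forall fun p => ?_)
      simp only [Pi.add_apply]; ring
     map_smul' := by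
      intro c v
      rw [form, form, Submodule.coe_smul, quot_smul, RingHom.id_apply, smul_eq_mul,
        ← integral_const_mul]
      refine integral_congr_ae (Eventually.of_forall fun p => ?_)
      simp only [Pi.smul_apply, smul_eq_mul]; ring },
   ⟨(dbl N.upper * (modular N.pair (pairMeasure d) (quot s (u : Space d → ℝ)) + 1)).toReal + 1,
    fun v => (abs_form_le u.2 v.2.1).trans (by
      refine mul_le_mul_of_nonneg_left ?_ (by positivity)
      exact le_add_of_nonneg_left (luxNorm_nonneg _))⟩⟩

theorem pairing_Lg {N : Nonlinearity d} {s : ℝ} {Ω : Set (Space d)} (u : W N s) (v : W₀ N s Ω) :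
    pairing (Lg Ω u) v = form N s u v := rfl

/-! ### The obstacle problems -/

/-- `𝕂₁ = {v ∈ W₀^{s,G}(Ω) : v ≥ ψ a.e. in Ω}`. -/
def K₁ (N : Nonlinearity d) (s : ℝ) (Ω : Set (Space d)) (ψ : Space d → ℝ) : Set (W₀ N s Ω) :=
  {v | ∀ᵐ x, x ∈ Ω → ψ x ≤ (v : Space d → ℝ) x}

/-- `𝕂₂ = {v ∈ W₀^{s,G}(Ω) : ψ ≤ v ≤ φ a.e. in Ω}`. -/
def K₂ (N : Nonlinearity d) (s : ℝ) (Ω : Set (Space d)) (ψ φ : Space d → ℝ) : Set (W₀ N s Ω) :=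
  {v | ∀ᵐ x, x ∈ Ω → ψ x ≤ (v : Space d → ℝ) x ∧ (v : Space d → ℝ) x ≤ φ x}

/-- `u` solves the variational inequality: `u ∈ K` and `⟨𝓛_g^s u - F, v - u⟩ ≥ 0` for all
`v ∈ K`. -/
def IsSolution {N : Nonlinearity d} {s : ℝ} {Ω : Set (Space d)} (K : Set (W₀ N s Ω))
    (F : Dual N s Ω) (u : W₀ N s Ω) : Prop :=
  u ∈ K ∧ ∀ v ∈ K, 0 ≤ pairing (Lg Ω (toW u) - F) (v - u)

end Spaces

end FracOrlicz

/-!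
The bounds on `𝓛 u` are obtained directly from the variational inequality, with no auxiliary
obstacle problem. Let `P = (𝓛 ψ - F)⁺`, let `w ≥ 0` be an element of `W₀^{s,G}(Ω)`, and for `ε > 0`
put `η = u - ψ ≥ 0` and `ξ = (εw - η)⁺`, so that `0 ≤ ξ ≤ εw`. The competitor
`max (u - εw) ψ = u - εw + ξ` is admissible, hence
`ε ⟨𝓛 u - F, w⟩ ≤ ⟨𝓛 u - F, ξ⟩ = ⟨𝓛 u - 𝓛 ψ, ξ⟩ + ⟨𝓛 ψ - F, ξ⟩ ≤ ⟨𝓛 u - 𝓛 ψ, ξ⟩ + ε ⟨P, w⟩`.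
It remains to see that `⟨𝓛 u - 𝓛 ψ, ξ⟩ ≤ o(ε)`, which is `exists_form_sub_le`: by monotonicity of
`r ↦ g(x,y,|r|) r` the integrand is at most `ε` times a fixed integrable function, and it can be
positive at `(x,y)` only if `0 < η < εw` at the point among `x`, `y` where `η` is larger, which
fails once `ε` is small; dominated convergence applies. Dividing by `ε` gives `𝓛 u - F ≤ P`. The
upper obstacle is treated in the same way with `η = φ - u` and the competitor `min (u + εw) φ`; the
common part is `le_of_le_Lg_sub_add`. Since the order is translation invariant, `F + P` is
`F ∨ 𝓛 ψ`, and `𝓛 φ - (𝓛 φ - F)⁺` is `F ∧ 𝓛 φ`.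

The competitors have to lie in `W₀^{s,G}(Ω)`, that is, `ξ = min (εw)⁺ (εw - η)⁺` has to be a limit of
test functions in `Ω` (`min_max_mem_W₀`). No regularity of `g` in `(x,y)` is available, so
mollification is not an option. Instead one composes test functions approximating `εw` and `εw - η`
with smooth Lipschitz approximations of `(x, y) ↦ min x⁺ y⁺` vanishing for `x ≤ 0`: such compositions
stay in `W^{s,G}` and have support in `Ω`. They converge along geometrically fast sequences, for
which both almost everywhere convergence and domination in the modular are at hand.
-/

namespace FracOrlicz


/-! ### Convergence in modular and in Luxemburg norm -/

theorem IsProfile.prim_ne_top {a b : ℝ} {h : ℝ → ℝ} (ha : 0 < a) (H : IsProfile a b h) (r : ℝ) :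
    prim h r ≠ ⊤ := by
  refine ne_top_of_le_ne_top (b := ENNReal.ofReal (r * h r) * volume (Ioc 0 r)) ?_ ?_
  · rw [Real.volume_Ioc]
    exact ENNReal.mul_ne_top ENNReal.ofReal_ne_top ENNReal.ofReal_ne_top
  · rw [← setLIntegral_const]
    exact setLIntegral_mono' measurableSet_Ioc fun ρ hρ =>
      ENNReal.ofReal_le_ofReal (H.mono ha hρ.1 hρ.2)

theorem IsProfile.prim_pos {a b : ℝ} {h : ℝ → ℝ} (ha : 0 < a) (H : IsProfile a b h) {r : ℝ}
    (hr : 0 < r) : 0 < prim h r := by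
  rw [pos_iff_ne_zero]
  intro h0
  have h1 := H.young ha hr.le hr.le
  rw [h0, add_zero, mul_zero, nonpos_iff_eq_zero, ENNReal.ofReal_eq_zero] at h1
  have := H.pos r hr
  exact absurd h1 (not_le.2 (by positivity))

theorem IsProfile.prim_two_pow {a b : ℝ} {h : ℝ → ℝ} (H : IsProfile a b h) (n : ℕ) (r : ℝ) :
    prim h (2 ^ n * r) ≤ dbl b ^ n * prim h r := by
  induction n with
  | zero => simp
  | succ n ih =>
    rw [pow_succ', mul_assoc, pow_succ', mul_assoc]
    exact (H.prim_double _).trans (by gcongr)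

theorem IsProfile.tendsto_prim_abs {a b : ℝ} {h : ℝ → ℝ} (ha : 0 < a) (H : IsProfile a b h)
    {x : ℕ → ℝ} (hx : Tendsto x atTop (𝓝 0)) :
    Tendsto (fun n => prim h |x n|) atTop (𝓝 0) := by
  have hx' : Tendsto (fun n => |x n|) atTop (𝓝 0) := by simpa using hx.abs
  have hlim : Tendsto (fun n => ENNReal.ofReal |x n| * prim h 1) atTop (𝓝 0) := by
    have := ENNReal.Tendsto.mul_const (b := prim h 1) (ENNReal.tendsto_ofReal hx')
      (Or.inr (H.prim_ne_top ha 1))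
    simpa using this
  refine tendsto_of_tendsto_of_tendsto_of_le_of_le' tendsto_const_nhds hlim
    (Eventually.of_forall fun _ => zero_le) ?_
  filter_upwards [hx'.eventually (ge_mem_nhds zero_lt_one)] with n hn
  rcases (abs_nonneg (x n)).eq_or_lt with h0 | h0
  · simp [← h0, prim]
  · simpa using H.prim_small ha h0 hn 1

theorem IsProfile.tendsto_zero_of_prim {a b : ℝ} {h : ℝ → ℝ} (ha : 0 < a) (H : IsProfile a b h)
    {x : ℕ → ℝ} (hx : Tendsto (fun n => prim h |x n|) atTop (𝓝 0)) :
    Tendsto x atTop (𝓝 0) := by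
  rw [Metric.tendsto_atTop']
  intro ε hε
  obtain ⟨n, hn⟩ := eventually_atTop.1 (hx.eventually (gt_mem_nhds (H.prim_pos ha hε)))
  refine ⟨n, fun m hm => ?_⟩
  rw [Real.dist_eq, sub_zero]
  by_contra! hc
  exact absurd (hn m hm.le) (not_lt.2 (prim_mono h hc))

section Convergence

variable {α : Type*} [MeasurableSpace α] {h : α → ℝ → ℝ} {μ : Measure α} {a b : ℝ}

theorem modular_le_of_luxNorm_lt (ha : 0 < a) (H : ∀ᵐ p ∂μ, IsProfile a b (h p)) {f : α → ℝ}
    (hfin : modular h μ f < ⊤) {ε : ℝ} (hε1 : ε ≤ 1) (hε : luxNorm h μ f < ε) :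
    modular h μ f ≤ ENNReal.ofReal ε := by
  obtain ⟨l, l0, l1, l2⟩ := exists_lt_of_luxNorm_lt ha H hfin hε
  have key : modular h μ f ≤ ENNReal.ofReal l * modular h μ (fun p => f p / l) := by
    unfold modular
    rw [← lintegral_const_mul' _ _ ENNReal.ofReal_ne_top]
    refine lintegral_mono_ae ?_
    filter_upwards [H] with p hp
    refine le_trans (le_of_eq ?_) (hp.prim_small ha l0 (l1.le.trans hε1) _)
    rw [abs_div, abs_of_pos l0]
    congr 1
    field_simp
  calc _ ≤ _ := key
    _ ≤ ENNReal.ofReal l * 1 := by gcongr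
    _ ≤ ENNReal.ofReal ε := by rw [mul_one]; exact ENNReal.ofReal_le_ofReal l1.le

theorem lintegral_tsum_prim_lt_top (hm : Measurable fun q : α × ℝ => h q.1 q.2)
    {f : ℕ → α → ℝ} (hf : ∀ n, AEMeasurable (f n) μ)
    (hs : ∀ n, modular h μ (f n) ≤ ENNReal.ofReal ((1 / 2) ^ n)) :
    ∫⁻ p, ∑' n, prim (h p) |f n p| ∂μ < ⊤ := by
  rw [lintegral_tsum fun n => aemeasurable_prim hm (hf n)]
  refine (ENNReal.tsum_le_tsum hs).trans_lt ?_
  rw [← ENNReal.ofReal_tsum_of_nonneg (fun n => by positivity) summable_geometric_two]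
  exact ENNReal.ofReal_lt_top

/-- Geometrically fast convergence in modular implies convergence almost everywhere. -/
theorem ae_tendsto_zero_of_modular_le (ha : 0 < a) (hm : Measurable fun q : α × ℝ => h q.1 q.2)
    (H : ∀ᵐ p ∂μ, IsProfile a b (h p)) {f : ℕ → α → ℝ} (hf : ∀ n, AEMeasurable (f n) μ)
    (hs : ∀ n, modular h μ (f n) ≤ ENNReal.ofReal ((1 / 2) ^ n)) :
    ∀ᵐ p ∂μ, Tendsto (fun n => f n p) atTop (𝓝 0) := by
  have h1 : ∀ᵐ p ∂μ, ∑' n, prim (h p) |f n p| < ⊤ :=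
    ae_lt_top' (AEMeasurable.tsum fun n => aemeasurable_prim hm (hf n))
      (lintegral_tsum_prim_lt_top hm hf hs).ne
  filter_upwards [h1, H] with p hp Hp
  exact Hp.tendsto_zero_of_prim ha (ENNReal.tendsto_atTop_zero_of_tsum_ne_top hp.ne)

/-- Dominated convergence in modular: the dominating functions `f n`, `k n` may vary with `n` as
long as they are geometrically small, because the sum over `n` of their modular densities is then
integrable. -/
theorem tendsto_modular_zero (ha : 0 < a) (hm : Measurable fun q : α × ℝ => h q.1 q.2)
    (H : ∀ᵐ p ∂μ, IsProfile a b (h p)) {f k r : ℕ → α → ℝ} {u v : α → ℝ} (K : ℝ)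
    (hf : ∀ n, AEMeasurable (f n) μ) (hk : ∀ n, AEMeasurable (k n) μ)
    (hu : AEMeasurable u μ) (hr : ∀ n, AEMeasurable (r n) μ)
    (hfs : ∀ n, modular h μ (f n) ≤ ENNReal.ofReal ((1 / 2) ^ n))
    (hks : ∀ n, modular h μ (k n) ≤ ENNReal.ofReal ((1 / 2) ^ n))
    (hufin : modular h μ u < ⊤) (hvfin : modular h μ v < ⊤)
    (hbound : ∀ n p, |r n p| ≤ K * ((|f n p| + |k n p|) + (|u p| + |v p|)))
    (hlim : ∀ᵐ p ∂μ, Tendsto (fun n => r n p) atTop (𝓝 0)) :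
    Tendsto (fun n => modular h μ (r n)) atTop (𝓝 0) := by
  obtain ⟨m, hm'⟩ := pow_unbounded_of_one_lt K (one_lt_two : (1 : ℝ) < 2)
  set D : α → ℝ≥0∞ := fun p => dbl b ^ m * (dbl b * (
    dbl b * (∑' n, prim (h p) |f n p| + ∑' n, prim (h p) |k n p|) +
    dbl b * (prim (h p) |u p| + prim (h p) |v p|))) with hD
  have hd := (dbl_lt_top b).ne
  have hDfin : ∫⁻ p, D p ∂μ ≠ ⊤ := by
    have e1 : AEMeasurable (fun p => ∑' n, prim (h p) |f n p|) μ :=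
      AEMeasurable.tsum fun n => aemeasurable_prim hm (hf n)
    have e2 : AEMeasurable (fun p => ∑' n, prim (h p) |k n p|) μ :=
      AEMeasurable.tsum fun n => aemeasurable_prim hm (hk n)
    have e12 : AEMeasurable (fun p => dbl b * (∑' n, prim (h p) |f n p| +
        ∑' n, prim (h p) |k n p|)) μ := (e1.add e2).const_mul _
    rw [hD, lintegral_const_mul' _ _ (ENNReal.pow_ne_top hd), lintegral_const_mul' _ _ hd,
      lintegral_add_left' e12, lintegral_const_mul' _ _ hd,
      lintegral_const_mul' _ _ hd, lintegral_add_left' e1,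
      lintegral_add_left' (aemeasurable_prim hm hu)]
    have t1 := (lintegral_tsum_prim_lt_top hm hf hfs).ne
    have t2 := (lintegral_tsum_prim_lt_top hm hk hks).ne
    exact ENNReal.mul_ne_top (ENNReal.pow_ne_top hd) (ENNReal.mul_ne_top hd
      (ENNReal.add_ne_top.2 ⟨ENNReal.mul_ne_top hd (ENNReal.add_ne_top.2 ⟨t1, t2⟩),
        ENNReal.mul_ne_top hd (ENNReal.add_ne_top.2 ⟨hufin.ne, hvfin.ne⟩)⟩))
  have key := tendsto_lintegral_of_dominated_convergence' (μ := μ)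
    (F := fun n p => prim (h p) |r n p|) (f := fun _ => 0) D (fun n => aemeasurable_prim hm (hr n)) ?_ hDfin ?_
  · simpa [modular] using key
  · intro n
    filter_upwards [H] with p hp
    have hs : ∀ x y : ℝ, prim (h p) (|x| + |y|) ≤ dbl b * (prim (h p) |x| + prim (h p) |y|) := by
      intro x y
      simpa [abs_of_nonneg (add_nonneg (abs_nonneg x) (abs_nonneg y))] using hp.prim_add |x| |y|
    have h1 : |r n p| ≤ 2 ^ m * ((|f n p| + |k n p|) + (|u p| + |v p|)) :=
      (hbound n p).trans (by gcongr)
    refine (prim_mono _ h1).trans ((hp.prim_two_pow m _).trans ?_)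
    simp only [hD]
    gcongr
    have h2 := hs (|f n p| + |k n p|) (|u p| + |v p|)
    rw [abs_of_nonneg (by positivity : 0 ≤ |f n p| + |k n p|),
      abs_of_nonneg (by positivity : 0 ≤ |u p| + |v p|)] at h2
    refine h2.trans ?_
    gcongr
    · refine (hs _ _).trans ?_
      gcongr
      · exact ENNReal.le_tsum (f := fun n => prim (h p) |f n p|) n
      · exact ENNReal.le_tsum (f := fun n => prim (h p) |k n p|) n
    · exact hs _ _
  · filter_upwards [H, hlim] with p hp hl
    exact hp.tendsto_prim_abs ha hl

/-- The analogue of `tendsto_modular_zero` for the Luxemburg norm. -/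
theorem eventually_luxNorm_le (ha : 0 < a) (hm : Measurable fun q : α × ℝ => h q.1 q.2)
    (H : ∀ᵐ p ∂μ, IsProfile a b (h p)) {f k r : ℕ → α → ℝ} {u v : α → ℝ} (K : ℝ)
    (hf : ∀ n, AEMeasurable (f n) μ) (hk : ∀ n, AEMeasurable (k n) μ)
    (hu : AEMeasurable u μ) (hr : ∀ n, AEMeasurable (r n) μ)
    (hfs : ∀ n, modular h μ (f n) ≤ ENNReal.ofReal ((1 / 2) ^ n))
    (hks : ∀ n, modular h μ (k n) ≤ ENNReal.ofReal ((1 / 2) ^ n))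
    (hufin : modular h μ u < ⊤) (hvfin : modular h μ v < ⊤)
    (hbound : ∀ n p, |r n p| ≤ K * ((|f n p| + |k n p|) + (|u p| + |v p|)))
    (hlim : ∀ᵐ p ∂μ, Tendsto (fun n => r n p) atTop (𝓝 0)) {ε : ℝ} (hε : 0 < ε) :
    ∀ᶠ n in atTop, luxNorm h μ (r n) ≤ ε := by
  have key := tendsto_modular_zero ha hm H (r := fun n p => r n p / ε) (K / ε) hf hk hu
    (fun n => (hr n).div_const ε) hfs hks hufin hvfin ?_ ?_
  · filter_upwards [key.eventually (ge_mem_nhds zero_lt_one)] with n hn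
    exact luxNorm_le hε hn
  · intro n p
    rw [abs_div, abs_of_pos hε, div_mul_eq_mul_div]
    gcongr
    exact hbound n p
  · filter_upwards [hlim] with p hp
    simpa using hp.div_const ε

end Convergence

/-! ### A smooth approximation of the positive part -/

/-- The functions `Φₙ(t) = t exp(-1 / ((n+1) t))` for `t > 0`, and `Φₙ(t) = 0` for `t ≤ 0`: smooth,
`1`-Lipschitz, vanishing on `(-∞, 0]`, and converging to the positive part as `n → ∞`. -/
noncomputable def smoothPos (n : ℕ) (t : ℝ) : ℝ := t * expNegInvGlue ((n + 1) * t)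

theorem contDiff_smoothPos (n : ℕ) : ContDiff ℝ ∞ (smoothPos n) :=
  contDiff_id.mul (expNegInvGlue.contDiff.comp (contDiff_const.mul contDiff_id))

theorem smoothPos_of_nonpos (n : ℕ) {t : ℝ} (ht : t ≤ 0) : smoothPos n t = 0 := by
  rw [smoothPos, expNegInvGlue.zero_of_nonpos (mul_nonpos_of_nonneg_of_nonpos (by positivity) ht),
    mul_zero]

theorem smoothPos_of_pos (n : ℕ) {t : ℝ} (ht : 0 < t) :
    smoothPos n t = t * Real.exp (-((n + 1) * t)⁻¹) := by
  rw [smoothPos, expNegInvGlue, if_neg (not_le.2 (by positivity))]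

theorem smoothPos_nonneg (n : ℕ) (t : ℝ) : 0 ≤ smoothPos n t := by
  rcases le_or_gt t 0 with ht | ht
  · rw [smoothPos_of_nonpos n ht]
  · rw [smoothPos_of_pos n ht]; positivity

theorem hasDerivAt_expNegInvGlue (x : ℝ) :
    HasDerivAt expNegInvGlue (x⁻¹ ^ 2 * expNegInvGlue x) x := by
  simpa using expNegInvGlue.hasDerivAt_polynomial_eval_inv_mul 1 x

theorem abs_deriv_smoothPos_le (n : ℕ) (t : ℝ) : |deriv (smoothPos n) t| ≤ 1 := by
  have hn : (0 : ℝ) < n + 1 := by positivity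
  have h1 : HasDerivAt (smoothPos n) (1 * expNegInvGlue ((n + 1) * t) +
      t * ((((n + 1) * t)⁻¹ ^ 2 * expNegInvGlue ((n + 1) * t)) * ((n + 1) * 1))) t :=
    (hasDerivAt_id t).mul ((hasDerivAt_expNegInvGlue _).comp t
      ((hasDerivAt_id t).const_mul ((n : ℝ) + 1)))
  rw [h1.deriv]
  rcases le_or_gt t 0 with ht | ht
  · rw [expNegInvGlue.zero_of_nonpos (mul_nonpos_of_nonneg_of_nonpos hn.le ht)]
    simp
  · set y := ((n : ℝ) + 1) * t with hy
    have hy0 : 0 < y := by positivity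
    have e : 1 * expNegInvGlue y + t * ((y⁻¹ ^ 2 * expNegInvGlue y) * ((n + 1) * 1)) =
        (y⁻¹ + 1) * expNegInvGlue y := by
      have : t * (y⁻¹ ^ 2 * ((n : ℝ) + 1)) = y⁻¹ := by
        rw [hy]; field_simp
      linear_combination expNegInvGlue y * this
    rw [e, abs_of_nonneg (mul_nonneg (by positivity) (expNegInvGlue.nonneg y)),
      expNegInvGlue, if_neg (not_le.2 hy0)]
    -- This is the inequality `1 + x ≤ exp x` at `x = y⁻¹`.
    calc (y⁻¹ + 1) * Real.exp (-y⁻¹) ≤ Real.exp y⁻¹ * Real.exp (-y⁻¹) := by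
          gcongr; exact Real.add_one_le_exp _
      _ = 1 := by rw [← Real.exp_add]; simp

theorem abs_smoothPos_sub_le (n : ℕ) (x y : ℝ) : |smoothPos n x - smoothPos n y| ≤ |x - y| := by
  have h1 : LipschitzWith 1 (smoothPos n) :=
    lipschitzWith_of_nnnorm_deriv_le ((contDiff_smoothPos n).differentiable (by simp)) fun t => by
      rw [← NNReal.coe_le_coe]; simpa using abs_deriv_smoothPos_le n t
  simpa [Real.dist_eq] using h1.dist_le_mul x y

theorem tendsto_smoothPos (t : ℝ) :
    Tendsto (fun n => smoothPos n t) atTop (𝓝 (max t 0)) := by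
  rcases le_or_gt t 0 with ht | ht
  · simp [smoothPos_of_nonpos _ ht, max_eq_right ht]
  · simp only [smoothPos_of_pos _ ht, max_eq_left ht.le]
    have h1 : Tendsto (fun n : ℕ => ((n : ℝ) + 1) * t) atTop atTop :=
      (tendsto_atTop_add_const_right _ _ tendsto_natCast_atTop_atTop).atTop_mul_const ht
    have h2 := (Real.continuous_exp.tendsto _).comp (tendsto_inv_atTop_zero.comp h1).neg
    simpa using h2.const_mul t


/-- The smooth approximation `Φₙ(x) - Φₙ(Φₙ(x) - Φₙ(y))` of `min x⁺ y⁺`. It vanishes wherever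
`x ≤ 0`, so composing it with functions preserves the support of the first one. -/
noncomputable def smoothMin (n : ℕ) (x y : ℝ) : ℝ :=
  smoothPos n x - smoothPos n (smoothPos n x - smoothPos n y)

theorem abs_smoothMin_sub_le (n : ℕ) (x y x' y' : ℝ) :
    |smoothMin n x y - smoothMin n x' y'| ≤ 2 * |x - x'| + |y - y'| := by
  have h1 := abs_smoothPos_sub_le n x x'
  have h2 := abs_smoothPos_sub_le n y y'
  have h3 := abs_smoothPos_sub_le n (smoothPos n x - smoothPos n y)
    (smoothPos n x' - smoothPos n y')
  have h4 := abs_sub (smoothPos n x - smoothPos n x') (smoothPos n y - smoothPos n y')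
  have h5 := abs_sub (smoothPos n x - smoothPos n x') (smoothPos n (smoothPos n x - smoothPos n y) -
    smoothPos n (smoothPos n x' - smoothPos n y'))
  rw [sub_sub_sub_comm] at h4 h5
  unfold smoothMin
  linarith

theorem smoothMin_zero_left (n : ℕ) (y : ℝ) : smoothMin n 0 y = 0 := by
  have := smoothPos_nonneg n y
  simp [smoothMin, smoothPos_of_nonpos n le_rfl, smoothPos_of_nonpos n (neg_nonpos.2 this)]

theorem abs_smoothMin_le (n : ℕ) (x y : ℝ) : |smoothMin n x y| ≤ 2 * |x| + |y| := by
  simpa [smoothMin_zero_left] using abs_smoothMin_sub_le n x y 0 0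

theorem tendsto_smoothPos_of_tendsto {t : ℕ → ℝ} {x : ℝ} (ht : Tendsto t atTop (𝓝 x)) :
    Tendsto (fun n => smoothPos n (t n)) atTop (𝓝 (max x 0)) := by
  have h1 : Tendsto (fun n => |t n - x|) atTop (𝓝 0) := by
    simpa using (ht.sub_const x).abs
  have h2 : Tendsto (fun n => smoothPos n (t n) - smoothPos n x) atTop (𝓝 0) :=
    squeeze_zero_norm (fun n => abs_smoothPos_sub_le n (t n) x) h1
  simpa using h2.add (tendsto_smoothPos x)

theorem tendsto_smoothMin {t r : ℕ → ℝ} {x y : ℝ} (ht : Tendsto t atTop (𝓝 x))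
    (hr : Tendsto r atTop (𝓝 y)) :
    Tendsto (fun n => smoothMin n (t n) (r n)) atTop (𝓝 (min (max x 0) (max y 0))) := by
  have h1 := tendsto_smoothPos_of_tendsto ht
  have h2 := h1.sub (tendsto_smoothPos_of_tendsto (h1.sub (tendsto_smoothPos_of_tendsto hr)))
  have e : ∀ X Y : ℝ, X - max (X - Y) 0 = min X Y := by
    intro X Y
    rcases le_total X Y with h | h
    · rw [max_eq_right (by linarith), min_eq_left h, sub_zero]
    · rw [max_eq_left (by linarith), min_eq_right h]; ring
  rw [e] at h2
  exact h2

theorem abs_min_max_sub_le (x y x' y' : ℝ) :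
    |min (max x 0) (max y 0) - min (max x' 0) (max y' 0)| ≤ 2 * |x - x'| + |y - y'| := by
  have h1 := abs_max_sub_max_le_abs x x' 0
  have h2 := abs_max_sub_max_le_abs y y' 0
  have h3 := abs_min_sub_min_le_max (max x 0) (max y 0) (max x' 0) (max y' 0)
  have h4 := abs_nonneg (x - x')
  have h5 := abs_nonneg (y - y')
  refine h3.trans (max_le ?_ ?_) <;> linarith

theorem abs_min_max_le (x y : ℝ) : |min (max x 0) (max y 0)| ≤ 2 * |x| + |y| := by
  simpa using abs_min_max_sub_le x y 0 0

/-! ### Lattice operations in `W^{s,G}` and `W₀^{s,G}` -/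

section Lattice

variable {d : ℕ} {N : Nonlinearity d} {s : ℝ} {Ω : Set (Space d)}

theorem quot_sub (s : ℝ) (u v : Space d → ℝ) : quot s (u - v) = quot s u - quot s v := by
  ext p; simp only [quot, Pi.sub_apply]; ring

theorem abs_quot_le {r f k : Space d → ℝ}
    (h : ∀ x y, |r x - r y| ≤ 2 * |f x - f y| + |k x - k y|) (p : Space d × Space d) :
    |quot s r p| ≤ 2 * |quot s f p| + |quot s k p| := by
  have h0 : 0 ≤ ‖p.1 - p.2‖ ^ s := by positivity
  simp only [quot, abs_div, abs_of_nonneg h0]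
  rw [← mul_div_assoc, ← add_div]
  exact div_le_div_of_nonneg_right (h _ _) h0

theorem modular_lt_top_of_abs_le {α : Type*} [MeasurableSpace α] {h : α → ℝ → ℝ} {μ : Measure α}
    {a b : ℝ} (hm : Measurable fun q : α × ℝ => h q.1 q.2) (H : ∀ᵐ p ∂μ, IsProfile a b (h p))
    {r f k : α → ℝ} (hf : AEMeasurable f μ) (hr : ∀ p, |r p| ≤ 2 * |f p| + |k p|)
    (hffin : modular h μ f < ⊤) (hkfin : modular h μ k < ⊤) : modular h μ r < ⊤ := by
  have e : ∀ f : α → ℝ, modular h μ (fun p => |f p|) = modular h μ f := by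
    intro f; simp [modular]
  have h1 : modular h μ (fun p => |((2 : ℝ) • f) p|) < ⊤ := by
    rw [e]; exact modular_smul H 2 hffin
  have h2 := modular_add hm H (k := fun p => |k p|) (hf.const_smul (2 : ℝ)).abs
  refine lt_of_le_of_lt ?_ (h2.trans_lt (ENNReal.mul_lt_top (dbl_lt_top b)
    (ENNReal.add_lt_top.2 ⟨h1, by rwa [e]⟩)))
  refine lintegral_mono fun p => prim_mono _ ?_
  refine (hr p).trans ((le_of_eq ?_).trans (le_abs_self _))
  simp [abs_mul]

theorem mem_W_of_abs_le {r f k : Space d → ℝ} (hr : AEMeasurable r)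
    (hf : f ∈ W N s) (hk : k ∈ W N s) (h0 : ∀ x, |r x| ≤ 2 * |f x| + |k x|)
    (h1 : ∀ x y, |r x - r y| ≤ 2 * |f x - f y| + |k x - k y|) : r ∈ W N s :=
  ⟨hr, modular_lt_top_of_abs_le N.measurable_diag N.profile_diag hf.1 h0 hf.2.1 hk.2.1,
    modular_lt_top_of_abs_le N.measurable_pair N.profile_pair (aemeasurable_quot s hf.1)
      (abs_quot_le h1) hf.2.2 hk.2.2⟩

theorem ae_pair {P : Space d → Prop} (h : ∀ᵐ x, P x) :
    ∀ᵐ p ∂(pairMeasure d), P p.1 ∧ P p.2 :=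
  (withDensity_absolutelyContinuous _ _).ae_le
    ((Measure.quasiMeasurePreserving_fst.ae h).and (Measure.quasiMeasurePreserving_snd.ae h))

/-- Elements of `W₀^{s,G}` are limits of test functions, geometrically fast in both modulars. -/
theorem exists_seq_isTest {u : Space d → ℝ} (hu : u ∈ W₀ N s Ω) :
    ∃ f : ℕ → Space d → ℝ, ∀ n, IsTest Ω (f n) ∧ f n ∈ W N s ∧
      modular N.diag volume (u - f n) ≤ ENNReal.ofReal ((1 / 2) ^ n) ∧
      modular N.pair (pairMeasure d) (quot s (u - f n)) ≤ ENNReal.ofReal ((1 / 2) ^ n) := by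
  have h : ∀ n : ℕ, ∃ f, IsTest Ω f ∧ f ∈ W N s ∧ normW N s (u - f) < (1 / 2) ^ n :=
    fun n => hu.2 _ (by positivity)
  choose f hf hfW hfn using h
  refine ⟨f, fun n => ⟨hf n, hfW n, ?_, ?_⟩⟩
  all_goals
    have hn := hfn n
    have hmem := sub_mem hu.1 (hfW n)
    have h1 : ((1 : ℝ) / 2) ^ n ≤ 1 := pow_le_one₀ (by norm_num) (by norm_num)
    have a1 := luxNorm_nonneg (h := N.diag) (μ := volume) (u - f n)
    have a2 := luxNorm_nonneg (h := N.pair) (μ := pairMeasure d) (quot s (u - f n))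
    unfold normW at hn
  · exact modular_le_of_luxNorm_lt (h := N.diag) N.lower_pos N.profile_diag hmem.2.1 h1 (by linarith)
  · exact modular_le_of_luxNorm_lt N.lower_pos N.profile_pair hmem.2.2 h1 (by linarith)

theorem ae_tendsto_of_modular_sub_le {u : Space d → ℝ} {f : ℕ → Space d → ℝ}
    (hu : AEMeasurable u) (hf : ∀ n, AEMeasurable (f n))
    (hs : ∀ n, modular N.diag volume (u - f n) ≤ ENNReal.ofReal ((1 / 2) ^ n)) :
    ∀ᵐ x, Tendsto (fun n => f n x) atTop (𝓝 (u x)) := by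
  filter_upwards [ae_tendsto_zero_of_modular_le N.lower_pos N.measurable_diag N.profile_diag
    (f := fun n => u - f n) (fun n => hu.sub (hf n)) hs] with x hx
  simpa using hx.const_sub (u x)

theorem ae_eq_zero_of_mem_W₀ {u : Space d → ℝ} (hu : u ∈ W₀ N s Ω) : ∀ᵐ x, x ∉ Ω → u x = 0 := by
  obtain ⟨f, hf⟩ := exists_seq_isTest hu
  filter_upwards [ae_tendsto_of_modular_sub_le hu.1.1 (fun n => (hf n).2.1.1)
    fun n => (hf n).2.2.1] with x hx hxΩ
  have h0 : ∀ n, f n x = 0 := fun n =>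
    image_eq_zero_of_notMem_tsupport fun h => hxΩ ((hf n).1.2.2 h)
  simp only [h0] at hx
  exact tendsto_nhds_unique hx tendsto_const_nhds

theorem W₀_mono {Ω' : Set (Space d)} (h : Ω ⊆ Ω') : W₀ N s Ω ≤ W₀ N s Ω' := by
  rintro u ⟨hu, hu'⟩
  refine ⟨hu, fun ε hε => ?_⟩
  obtain ⟨f, hf, hfW, hfn⟩ := hu' ε hε
  exact ⟨f, ⟨hf.1, hf.2.1, hf.2.2.trans h⟩, hfW, hfn⟩

theorem IsTest.smoothMin {Ω' : Set (Space d)} {f k : Space d → ℝ} (hf : IsTest Ω f)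
    (hk : IsTest Ω' k) (n : ℕ) : IsTest Ω fun x => smoothMin n (f x) (k x) := by
  have hΦ := contDiff_smoothPos n
  have hs : tsupport (fun x => FracOrlicz.smoothMin n (f x) (k x)) ⊆ tsupport f := by
    refine closure_mono fun x hx => ?_
    rw [Function.mem_support] at hx ⊢
    intro h0
    exact hx (by rw [h0, smoothMin_zero_left])
  refine ⟨?_, hf.2.1.of_isClosed_subset (isClosed_tsupport _) hs, hs.trans hf.2.2⟩
  exact (hΦ.comp hf.1).sub (hΦ.comp ((hΦ.comp hf.1).sub (hΦ.comp hk.1)))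

theorem min_max_mem_W {w k : Space d → ℝ} (hw : w ∈ W N s) (hk : k ∈ W N s) :
    (fun x => min (max (w x) 0) (max (k x) 0)) ∈ W N s :=
  mem_W_of_abs_le ((hw.1.max aemeasurable_const).min (hk.1.max aemeasurable_const)) hw hk
    (fun _ => abs_min_max_le _ _) fun _ _ => abs_min_max_sub_le _ _ _ _

/-- A function of `W₀^{s,G}(ℝ^d)` becomes an element of `W₀^{s,G}(Ω)` when its positive part is
truncated by an element of `W₀^{s,G}(Ω)`. If `fₙ → w` and `kₙ → k` are test functions converging
fast, then `smoothMin n fₙ kₙ` are test functions in `Ω`, and they converge to `min w⁺ k⁺`. -/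
theorem min_max_mem_W₀ {Ω' : Set (Space d)} {w k : Space d → ℝ} (hw : w ∈ W₀ N s Ω)
    (hk : k ∈ W₀ N s Ω') : (fun x => min (max (w x) 0) (max (k x) 0)) ∈ W₀ N s Ω := by
  have hmW := min_max_mem_W hw.1 hk.1
  refine ⟨hmW, fun ε hε => ?_⟩
  obtain ⟨f, hf⟩ := exists_seq_isTest hw
  obtain ⟨g, hg⟩ := exists_seq_isTest hk
  set m : Space d → ℝ := fun x => min (max (w x) 0) (max (k x) 0) with hm
  set t : ℕ → Space d → ℝ := fun n x => smoothMin n (f n x) (g n x) with ht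
  have htest : ∀ n, IsTest Ω (t n) := fun n => (hf n).1.smoothMin (hg n).1 n
  have htW : ∀ n, t n ∈ W N s := fun n =>
    mem_W_of_abs_le (htest n).1.continuous.aemeasurable (hf n).2.1 (hg n).2.1
      (fun _ => abs_smoothMin_le _ _ _) fun _ _ => abs_smoothMin_sub_le _ _ _ _ _
  have hae : ∀ᵐ x, Tendsto (fun n => t n x) atTop (𝓝 (m x)) := by
    filter_upwards [ae_tendsto_of_modular_sub_le hw.1.1 (fun n => (hf n).2.1.1)
      fun n => (hf n).2.2.1, ae_tendsto_of_modular_sub_le hk.1.1 (fun n => (hg n).2.1.1)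
      fun n => (hg n).2.2.1] with x h1 h2
    exact tendsto_smoothMin h1 h2
  have hbound : ∀ M T w' e k' e' : ℝ, |M| ≤ 2 * |w'| + |k'| →
      |T| ≤ 2 * |w' - e| + |k' - e'| → |M - T| ≤ 4 * ((|e| + |e'|) + (|w'| + |k'|)) := by
    intro M T w' e k' e' h1 h2
    have := abs_sub M T
    have := abs_sub w' e
    have := abs_sub k' e'
    have := abs_nonneg e
    have := abs_nonneg e'
    have := abs_nonneg k'
    linarith
  have hd := eventually_luxNorm_le (ε := ε / 4) (r := fun n => m - t n) (f := fun n => w - f n)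
    (k := fun n => k - g n) (u := w) (v := k) N.lower_pos N.measurable_diag N.profile_diag 4
    (fun n => hw.1.1.sub (hf n).2.1.1) (fun n => hk.1.1.sub (hg n).2.1.1) hw.1.1
    (fun n => hmW.1.sub (htW n).1) (fun n => (hf n).2.2.1) (fun n => (hg n).2.2.1)
    hw.1.2.1 hk.1.2.1 ?_ ?_ (by positivity)
  · have hp := eventually_luxNorm_le (ε := ε / 4) (r := fun n => quot s (m - t n))
      (f := fun n => quot s (w - f n)) (k := fun n => quot s (k - g n)) (u := quot s w)
      (v := quot s k) N.lower_pos N.measurable_pair N.profile_pair 4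
      (fun n => aemeasurable_quot s (hw.1.1.sub (hf n).2.1.1))
      (fun n => aemeasurable_quot s (hk.1.1.sub (hg n).2.1.1)) (aemeasurable_quot s hw.1.1)
      (fun n => aemeasurable_quot s (hmW.1.sub (htW n).1)) (fun n => (hf n).2.2.2)
      (fun n => (hg n).2.2.2) hw.1.2.2 hk.1.2.2 ?_ ?_ (by positivity)
    · obtain ⟨n, hn1, hn2⟩ := (hd.and hp).exists
      refine ⟨t n, htest n, htW n, ?_⟩
      unfold normW
      linarith
    · intro n p
      simp only [quot_sub, Pi.sub_apply]
      refine hbound _ _ _ _ _ _ (abs_quot_le (fun _ _ => abs_min_max_sub_le _ _ _ _) p) ?_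
      simp only [sub_sub_cancel]
      exact abs_quot_le (fun _ _ => abs_smoothMin_sub_le _ _ _ _ _) p
    · filter_upwards [ae_pair hae] with p hp
      have h1 : Tendsto (fun n => (m - t n) p.1 - (m - t n) p.2) atTop (𝓝 0) := by
        simpa using (hp.1.const_sub (m p.1)).sub (hp.2.const_sub (m p.2))
      simpa [quot] using h1.div_const (‖p.1 - p.2‖ ^ s)
  · intro n x
    simp only [Pi.sub_apply]
    refine hbound _ _ _ _ _ _ (abs_min_max_le _ _) ?_
    simp only [sub_sub_cancel]
    exact abs_smoothMin_le _ _ _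
  · filter_upwards [hae] with x hx
    simpa using hx.const_sub (m x)

end Lattice


/-! ### Refined T-monotonicity of the operator -/

theorem IsProfile.flux_mono {a b : ℝ} {h : ℝ → ℝ} (ha : 0 < a) (H : IsProfile a b h) {r R : ℝ}
    (hrR : r ≤ R) : h |r| * r ≤ h |R| * R := by
  have hpos : ∀ x : ℝ, 0 ≤ x → 0 ≤ h |x| * x := by
    intro x hx
    rcases hx.eq_or_lt with rfl | hx
    · simp
    · rw [abs_of_pos hx]; exact (mul_pos (H.pos x hx) hx).le
  have hneg : ∀ x : ℝ, x ≤ 0 → h |x| * x ≤ 0 := by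
    intro x hx
    have := hpos (-x) (by linarith)
    rw [abs_neg] at this
    linarith
  rcases lt_or_ge 0 r with hr | hr
  · have := H.mono ha hr hrR
    rw [abs_of_pos hr, abs_of_pos (hr.trans_le hrR)]
    linarith
  rcases le_or_gt 0 R with hR | hR
  · exact (hneg r hr).trans (hpos R hR)
  · have := H.mono ha (neg_pos.2 hR) (neg_le_neg hrR)
    rw [abs_of_neg hR, abs_of_nonpos hr]
    linarith

section Monotone

variable {d : ℕ} {N : Nonlinearity d} {s : ℝ} {Ω : Set (Space d)}

/-- The pointwise form of the estimate: with `η = u₁ - u₂ ≥ 0` and `ξ = (εw - η)⁺`, the increment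
of `ξ` can have the sign of the increment of `η` only where `η < εw` at the point at which `η` is
larger, and there it is at most `ε` times the increment of `w`. -/
theorem flux_sub_mul_quot_le {p : Space d × Space d} {a b : ℝ} (ha : 0 < a)
    (H : IsProfile a b (N.g p.1 p.2)) {u₁ u₂ w ξ : Space d → ℝ} {ε : ℝ} (hε : 0 < ε)
    (h1 : u₂ p.1 ≤ u₁ p.1 ∧ u₂ p.2 ≤ u₁ p.2)
    (hξ : ξ p.1 = max (ε * w p.1 - (u₁ p.1 - u₂ p.1)) 0 ∧
      ξ p.2 = max (ε * w p.2 - (u₁ p.2 - u₂ p.2)) 0) :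
    (N.g p.1 p.2 |quot s u₁ p| * quot s u₁ p - N.g p.1 p.2 |quot s u₂ p| * quot s u₂ p) *
        quot s ξ p ≤
      ε * |(N.g p.1 p.2 |quot s u₁ p| * quot s u₁ p - N.g p.1 p.2 |quot s u₂ p| * quot s u₂ p) *
        quot s w p| ∧
    (((0 < u₁ p.1 - u₂ p.1 → ε * w p.1 ≤ u₁ p.1 - u₂ p.1) ∧
      (0 < u₁ p.2 - u₂ p.2 → ε * w p.2 ≤ u₁ p.2 - u₂ p.2)) →
      (N.g p.1 p.2 |quot s u₁ p| * quot s u₁ p - N.g p.1 p.2 |quot s u₂ p| * quot s u₂ p) *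
        quot s ξ p ≤ 0) := by
  have hc : 0 ≤ ‖p.1 - p.2‖ ^ s := by positivity
  have key : ∀ x y : Space d, u₂ y ≤ u₁ y → ξ x = max (ε * w x - (u₁ x - u₂ x)) 0 →
      ξ y = max (ε * w y - (u₁ y - u₂ y)) 0 → u₁ y - u₂ y < u₁ x - u₂ x →
      ξ x - ξ y ≤ ε * |w x - w y| ∧
      ((0 < u₁ x - u₂ x → ε * w x ≤ u₁ x - u₂ x) → ξ x - ξ y ≤ 0) := by
    intro x y hy hξx hξy hlt
    have hy0 : 0 ≤ ξ y := by rw [hξy]; exact le_max_right _ _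
    have hy1 : ε * w y - (u₁ y - u₂ y) ≤ ξ y := by rw [hξy]; exact le_max_left _ _
    have hw : ε * (w x - w y) ≤ ε * |w x - w y| := by gcongr; exact le_abs_self _
    constructor
    · rw [hξx, sub_le_iff_le_add]
      refine max_le ?_ ?_
      · linarith
      · positivity
    · intro h
      rw [hξx, max_eq_right (by linarith [h (by linarith)])]
      linarith
  set A := N.g p.1 p.2 |quot s u₁ p| * quot s u₁ p - N.g p.1 p.2 |quot s u₂ p| * quot s u₂ p
    with hA
  have hqw : ε * |w p.1 - w p.2| / ‖p.1 - p.2‖ ^ s = ε * |quot s w p| := by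
    rw [quot, abs_div, abs_of_nonneg hc, mul_div_assoc]
  have hqw' : |w p.2 - w p.1| = |w p.1 - w p.2| := abs_sub_comm _ _
  rcases lt_trichotomy (u₁ p.2 - u₂ p.2) (u₁ p.1 - u₂ p.1) with hlt | heq | hlt
  · obtain ⟨k1, k2⟩ := key p.1 p.2 h1.2 hξ.1 hξ.2 hlt
    have hA0 : 0 ≤ A := by
      refine sub_nonneg.2 (H.flux_mono ha ?_)
      exact div_le_div_of_nonneg_right (by linarith) hc
    constructor
    · have : quot s ξ p ≤ ε * |quot s w p| := by
        rw [← hqw]; exact div_le_div_of_nonneg_right k1 hc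
      rw [abs_mul, abs_of_nonneg hA0]
      calc A * quot s ξ p ≤ A * (ε * |quot s w p|) := by gcongr
        _ = _ := by ring
    · intro h
      exact mul_nonpos_of_nonneg_of_nonpos hA0 (div_nonpos_of_nonpos_of_nonneg (k2 h.1) hc)
  · have e : quot s u₁ p = quot s u₂ p := by
      unfold quot; congr 1; linarith
    have hA0 : A = 0 := by rw [hA, e, sub_self]
    simp [hA0]
  · obtain ⟨k1, k2⟩ := key p.2 p.1 h1.1 hξ.2 hξ.1 hlt
    have hA0 : A ≤ 0 := by
      refine sub_nonpos.2 (H.flux_mono ha ?_)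
      exact div_le_div_of_nonneg_right (by linarith) hc
    have hq : -quot s ξ p = (ξ p.2 - ξ p.1) / ‖p.1 - p.2‖ ^ s := by
      unfold quot; ring
    constructor
    · have : -quot s ξ p ≤ ε * |quot s w p| := by
        rw [← hqw, hq, ← hqw']; exact div_le_div_of_nonneg_right k1 hc
      rw [abs_mul, abs_of_nonpos hA0]
      calc A * quot s ξ p = -A * -quot s ξ p := by ring
        _ ≤ -A * (ε * |quot s w p|) := by gcongr; linarith
        _ = _ := by ring
    · intro h
      have : -quot s ξ p ≤ 0 := by
        rw [hq]; exact div_nonpos_of_nonpos_of_nonneg (k2 h.2) hc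
      exact mul_nonpos_of_nonpos_of_nonneg hA0 (by linarith)

/-- If `u₁ ≥ u₂` and `ξₙ = (w / (n+1) - (u₁ - u₂))⁺`, then
`⟨𝓛 u₁ - 𝓛 u₂, ξₙ⟩ ≤ o(1 / (n+1))`; for a given `τ > 0` a single `n` with the bound
`τ / (n+1)` is all that is needed. -/
theorem exists_form_sub_le {u₁ u₂ w : Space d → ℝ} (hu₁ : u₁ ∈ W N s) (hu₂ : u₂ ∈ W N s)
    (hw : w ∈ W N s) (hle : ∀ᵐ x, u₂ x ≤ u₁ x) {ξ : ℕ → Space d → ℝ} (hξW : ∀ n, ξ n ∈ W N s)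
    (hξ : ∀ n, ∀ᵐ x, ξ n x = max (1 / ((n : ℝ) + 1) * w x - (u₁ x - u₂ x)) 0) {τ : ℝ}
    (hτ : 0 < τ) :
    ∃ n : ℕ, form N s u₁ (ξ n) - form N s u₂ (ξ n) ≤ 1 / ((n : ℝ) + 1) * τ := by
  set A : Space d × Space d → ℝ := fun p => N.g p.1 p.2 |quot s u₁ p| * quot s u₁ p -
    N.g p.1 p.2 |quot s u₂ p| * quot s u₂ p with hA
  have hint : ∀ v ∈ W N s, Integrable (fun p => A p * quot s v p) (pairMeasure d) := by
    intro v hv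
    refine ((integrable_form hu₁ hv).sub (integrable_form hu₂ hv)).congr
      (Eventually.of_forall fun p => ?_)
    simp only [hA, Pi.sub_apply]; ring
  have hform : ∀ v ∈ W N s, form N s u₁ v - form N s u₂ v =
      ∫ p, A p * quot s v p ∂(pairMeasure d) := by
    intro v hv
    rw [form, form, ← integral_sub (integrable_form hu₁ hv) (integrable_form hu₂ hv)]
    refine integral_congr_ae (Eventually.of_forall fun p => ?_)
    simp only [hA]; ring
  have hpt : ∀ᵐ p ∂(pairMeasure d), ∀ n : ℕ,
      A p * quot s (ξ n) p ≤ 1 / ((n : ℝ) + 1) * |A p * quot s w p| ∧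
      (((0 < u₁ p.1 - u₂ p.1 → 1 / ((n : ℝ) + 1) * w p.1 ≤ u₁ p.1 - u₂ p.1) ∧
        (0 < u₁ p.2 - u₂ p.2 → 1 / ((n : ℝ) + 1) * w p.2 ≤ u₁ p.2 - u₂ p.2)) →
        A p * quot s (ξ n) p ≤ 0) := by
    rw [ae_all_iff]
    intro n
    filter_upwards [N.profile_pair, ae_pair hle, ae_pair (hξ n)] with p hp h1 h2
    exact flux_sub_mul_quot_le N.lower_pos hp (by positivity) h1 h2
  have hlim : Tendsto (fun n : ℕ => ∫ p, max (((n : ℝ) + 1) * (A p * quot s (ξ n) p)) 0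
      ∂(pairMeasure d)) atTop (𝓝 (∫ _, (0 : ℝ) ∂(pairMeasure d))) := by
    refine tendsto_integral_of_dominated_convergence (fun p => |A p * quot s w p|) ?_
      (hint w hw).abs ?_ ?_
    · intro n
      exact (((hint _ (hξW n)).const_mul _).sup (integrable_zero _ _ _)).aestronglyMeasurable
    · intro n
      filter_upwards [hpt] with p hp
      have hn : (0 : ℝ) < n + 1 := by positivity
      rw [Real.norm_eq_abs, abs_of_nonneg (le_max_right _ _)]
      refine max_le ?_ (abs_nonneg _)
      have := mul_le_mul_of_nonneg_left (hp n).1 hn.le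
      rwa [← mul_assoc _ (1 / _), mul_one_div_cancel hn.ne', one_mul] at this
    · filter_upwards [hpt] with p hp
      have hsmall : ∀ x : Space d, ∀ᶠ n : ℕ in atTop,
          0 < u₁ x - u₂ x → 1 / ((n : ℝ) + 1) * w x ≤ u₁ x - u₂ x := by
        intro x
        rcases le_or_gt (u₁ x - u₂ x) 0 with h0 | h0
        · exact Eventually.of_forall fun n h => absurd h (not_lt.2 h0)
        · have : Tendsto (fun n : ℕ => 1 / ((n : ℝ) + 1) * w x) atTop (𝓝 (0 * w x)) :=
            tendsto_one_div_add_atTop_nhds_zero_nat.mul_const _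
          rw [zero_mul] at this
          filter_upwards [this.eventually (ge_mem_nhds h0)] with n hn _ using hn
      refine tendsto_const_nhds.congr' ?_
      filter_upwards [hsmall p.1, hsmall p.2] with n h1 h2
      refine (max_eq_right ?_).symm
      exact mul_nonpos_of_nonneg_of_nonpos (by positivity) ((hp n).2 ⟨h1, h2⟩)
  rw [integral_zero] at hlim
  obtain ⟨n, hn⟩ := (hlim.eventually (gt_mem_nhds hτ)).exists
  refine ⟨n, ?_⟩
  have hn0 : (0 : ℝ) < n + 1 := by positivity
  rw [hform _ (hξW n), one_div, ← div_eq_inv_mul, le_div_iff₀' hn0, ← integral_const_mul]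
  refine le_trans ?_ hn.le
  exact integral_mono ((hint _ (hξW n)).const_mul _)
    (((hint _ (hξW n)).const_mul _).sup (integrable_zero _ _ _)) fun p => le_max_left _ _

/-! ### Comparison of dual functionals and the obstacle problems -/

theorem pairing_add (F F' : Dual N s Ω) (v : W₀ N s Ω) :
    pairing (F + F') v = pairing F v + pairing F' v := rfl

theorem pairing_sub (F F' : Dual N s Ω) (v : W₀ N s Ω) :
    pairing (F - F') v = pairing F v - pairing F' v := rfl

theorem pairing_zero (v : W₀ N s Ω) : pairing (0 : Dual N s Ω) v = 0 := rfl

theorem pairing_sub_right (F : Dual N s Ω) (v w : W₀ N s Ω) :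
    pairing F (v - w) = pairing F v - pairing F w := map_sub _ _ _

theorem pairing_smul_right (F : Dual N s Ω) (c : ℝ) (v : W₀ N s Ω) :
    pairing F (c • v) = c * pairing F v := map_smul _ _ _

/-- The comparison principle behind both estimates. Here `u₁ ≥ u₂` and `T` is a functional with
`T ≤ 𝓛 u₁ - 𝓛 u₂ + P`, which moreover is nonpositive on `εw - (εw - (u₁ - u₂))⁺`, the part of the
perturbation `εw` that does not violate the obstacle. Then `T ≤ P`. -/
theorem le_of_le_Lg_sub_add {u₁ u₂ : W N s} {T P : Dual N s Ω} (hP : 0 ≤ P)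
    (h₀ : (u₁ - u₂ : Space d → ℝ) ∈ W₀ N s univ)
    (hle : ∀ᵐ x, (u₂ : Space d → ℝ) x ≤ (u₁ : Space d → ℝ) x)
    (hT : T ≤ Lg Ω u₁ - Lg Ω u₂ + P)
    (hvi : ∀ ε : ℝ, 0 < ε → ∀ w ξ : W₀ N s Ω, (0 : Space d → ℝ) ≤ᵐ[volume] w →
      (∀ᵐ x, (ξ : Space d → ℝ) x = max (ε * (w : Space d → ℝ) x -
        ((u₁ : Space d → ℝ) x - (u₂ : Space d → ℝ) x)) 0) → ε * pairing T w ≤ pairing T ξ) :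
    T ≤ P := by
  intro w hw
  refine le_of_forall_pos_le_add fun τ hτ => ?_
  -- Truncating `ξ` by `εw` does not change it almost everywhere, as `u₁ - u₂ ≥ 0`, but shows that it
  -- belongs to `W₀(Ω)` although `u₁ - u₂` need not.
  have hmem : ∀ n : ℕ, (fun x => min (max (((1 / ((n : ℝ) + 1)) • (w : Space d → ℝ)) x) 0)
      (max (((1 / ((n : ℝ) + 1)) • (w : Space d → ℝ) - (u₁ - u₂ : Space d → ℝ)) x) 0)) ∈
      W₀ N s Ω := fun n =>
    min_max_mem_W₀ (Submodule.smul_mem _ _ w.2)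
      (sub_mem (Submodule.smul_mem _ _ (W₀_mono (subset_univ Ω) w.2)) h₀)
  set ξ : ℕ → W₀ N s Ω := fun n => ⟨_, hmem n⟩ with hξdef
  have hξ : ∀ n : ℕ, ∀ᵐ x, (ξ n : Space d → ℝ) x = max (1 / ((n : ℝ) + 1) *
      (w : Space d → ℝ) x - ((u₁ : Space d → ℝ) x - (u₂ : Space d → ℝ) x)) 0 := by
    intro n
    filter_upwards [hle] with x hx
    simp only [hξdef, Pi.smul_apply, Pi.sub_apply, smul_eq_mul]
    exact min_eq_right (max_le_max_right 0 (by linarith))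
  obtain ⟨n, hn⟩ := exists_form_sub_le u₁.2 u₂.2 w.2.1 hle (fun n => (ξ n).2.1) hξ hτ
  have hε : (0 : ℝ) < 1 / ((n : ℝ) + 1) := by positivity
  have h1 := hvi _ hε w (ξ n) hw (hξ n)
  have h2 := hT (ξ n) (by
    filter_upwards [hξ n] with x hx
    rw [hx]; exact le_max_right _ _)
  rw [pairing_add, pairing_sub, pairing_Lg, pairing_Lg] at h2
  have h3 := hP ((1 / ((n : ℝ) + 1)) • w - ξ n) (by
    filter_upwards [hξ n, hle, hw] with x hx h4 h5
    simp only [Pi.zero_apply] at h5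
    simp only [Submodule.coe_sub, Submodule.coe_smul, Pi.sub_apply, Pi.smul_apply, smul_eq_mul,
      Pi.zero_apply, hx, sub_nonneg]
    exact max_le (by linarith) (by positivity))
  rw [pairing_zero, pairing_sub_right, pairing_smul_right] at h3
  refine le_of_mul_le_mul_left ?_ hε
  linarith

/-- The upper bound for a solution: it uses the admissible competitors
`max (u - εw) ψ = u - εw + (εw - (u - ψ))⁺`. -/
theorem Lg_sub_le_of_isSolution {K : Set (W₀ N s Ω)} {F P : Dual N s Ω} {ψ : W N s}
    {u : W₀ N s Ω} (hψ : (ψ : Space d → ℝ) ∈ W₀ N s univ)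
    (hψ0 : ∀ᵐ x, x ∉ Ω → (ψ : Space d → ℝ) x ≤ 0) (hP : 0 ≤ P) (hψP : Lg Ω ψ - F ≤ P)
    (hu : IsSolution K F u) (huψ : ∀ᵐ x, x ∈ Ω → (ψ : Space d → ℝ) x ≤ (u : Space d → ℝ) x)
    (hK : ∀ v : W₀ N s Ω, (∀ᵐ x, x ∈ Ω → (ψ : Space d → ℝ) x ≤ (v : Space d → ℝ) x) →
      (∀ᵐ x, (v : Space d → ℝ) x ≤ (u : Space d → ℝ) x) → v ∈ K) :
    Lg Ω (toW u) - F ≤ P := by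
  have hle : ∀ᵐ x, (ψ : Space d → ℝ) x ≤ (u : Space d → ℝ) x := by
    filter_upwards [hψ0, huψ, ae_eq_zero_of_mem_W₀ u.2] with x h1 h2 h3
    by_cases hx : x ∈ Ω
    · exact h2 hx
    · rw [h3 hx]; exact h1 hx
  refine le_of_le_Lg_sub_add (u₁ := toW u) (u₂ := ψ) hP
    (sub_mem (W₀_mono (subset_univ Ω) u.2) hψ) hle ?_ ?_
  · intro v hv
    have := hψP v hv
    simp only [pairing_add, pairing_sub] at this ⊢
    linarith
  · intro ε hε w ξ hw hξ
    have hξ' : ∀ᵐ x, (ξ : Space d → ℝ) x = max (ε * (w : Space d → ℝ) x -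
        ((u : Space d → ℝ) x - (ψ : Space d → ℝ) x)) 0 := hξ
    have h1 := hu.2 (u - ε • w + ξ) (hK _ ?_ ?_)
    · rw [show u - ε • w + ξ - u = ξ - ε • w by abel, pairing_sub_right, pairing_smul_right] at h1
      linarith
    · filter_upwards [hξ'] with x hx _
      simp only [Submodule.coe_add, Submodule.coe_sub, Submodule.coe_smul, Pi.add_apply,
        Pi.sub_apply, Pi.smul_apply, smul_eq_mul, hx]
      linarith [le_max_left (ε * (w : Space d → ℝ) x -
        ((u : Space d → ℝ) x - (ψ : Space d → ℝ) x)) 0]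
    · filter_upwards [hξ', hle, hw] with x hx h2 h3
      simp only [Pi.zero_apply] at h3
      have h4 : (ξ : Space d → ℝ) x ≤ ε * (w : Space d → ℝ) x := by
        rw [hx]; exact max_le (by linarith) (by positivity)
      simp only [Submodule.coe_add, Submodule.coe_sub, Submodule.coe_smul, Pi.add_apply,
        Pi.sub_apply, Pi.smul_apply, smul_eq_mul]
      linarith

/-- The lower bound for a solution: it uses the admissible competitors
`min (u + εw) φ = u + εw - (εw - (φ - u))⁺`. -/
theorem sub_Lg_le_of_isSolution {K : Set (W₀ N s Ω)} {F P : Dual N s Ω} {φ : W N s}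
    {u : W₀ N s Ω} (hφ : (φ : Space d → ℝ) ∈ W₀ N s univ)
    (hφ0 : ∀ᵐ x, x ∉ Ω → 0 ≤ (φ : Space d → ℝ) x) (hP : 0 ≤ P) (hφP : F - Lg Ω φ ≤ P)
    (hu : IsSolution K F u) (huφ : ∀ᵐ x, x ∈ Ω → (u : Space d → ℝ) x ≤ (φ : Space d → ℝ) x)
    (hK : ∀ v : W₀ N s Ω, (∀ᵐ x, x ∈ Ω → (v : Space d → ℝ) x ≤ (φ : Space d → ℝ) x) →
      (∀ᵐ x, (u : Space d → ℝ) x ≤ (v : Space d → ℝ) x) → v ∈ K) :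
    F - Lg Ω (toW u) ≤ P := by
  have hle : ∀ᵐ x, (u : Space d → ℝ) x ≤ (φ : Space d → ℝ) x := by
    filter_upwards [hφ0, huφ, ae_eq_zero_of_mem_W₀ u.2] with x h1 h2 h3
    by_cases hx : x ∈ Ω
    · exact h2 hx
    · rw [h3 hx]; exact h1 hx
  refine le_of_le_Lg_sub_add (u₁ := φ) (u₂ := toW u) hP
    (sub_mem hφ (W₀_mono (subset_univ Ω) u.2)) hle ?_ ?_
  · intro v hv
    have := hφP v hv
    simp only [pairing_add, pairing_sub] at this ⊢
    linarith
  · intro ε hε w ξ hw hξ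
    have hξ' : ∀ᵐ x, (ξ : Space d → ℝ) x = max (ε * (w : Space d → ℝ) x -
        ((φ : Space d → ℝ) x - (u : Space d → ℝ) x)) 0 := hξ
    have h1 := hu.2 (u + ε • w - ξ) (hK _ ?_ ?_)
    · rw [show u + ε • w - ξ - u = ε • w - ξ by abel, pairing_sub_right, pairing_smul_right] at h1
      simp only [pairing_sub] at h1 ⊢
      linarith
    · filter_upwards [hξ'] with x hx _
      simp only [Submodule.coe_add, Submodule.coe_sub, Submodule.coe_smul, Pi.add_apply,
        Pi.sub_apply, Pi.smul_apply, smul_eq_mul, hx]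
      linarith [le_max_left (ε * (w : Space d → ℝ) x -
        ((φ : Space d → ℝ) x - (u : Space d → ℝ) x)) 0]
    · filter_upwards [hξ', hle, hw] with x hx h2 h3
      simp only [Pi.zero_apply] at h3
      have h4 : (ξ : Space d → ℝ) x ≤ ε * (w : Space d → ℝ) x := by
        rw [hx]; exact max_le (by linarith) (by positivity)
      simp only [Submodule.coe_add, Submodule.coe_sub, Submodule.coe_smul, Pi.add_apply,
        Pi.sub_apply, Pi.smul_apply, smul_eq_mul]
      linarith

/-- In one-obstacle problems `u + w` is admissible for every `w ≥ 0`. -/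
theorem le_Lg_of_isSolution_K₁ {F : Dual N s Ω} {ψ : Space d → ℝ} {u : W₀ N s Ω}
    (hu : IsSolution (K₁ N s Ω ψ) F u) : F ≤ Lg Ω (toW u) := by
  intro w hw
  have hmem : u + w ∈ K₁ N s Ω ψ := by
    have h1 : ∀ᵐ x, x ∈ Ω → ψ x ≤ (u : Space d → ℝ) x := hu.1
    change ∀ᵐ x, x ∈ Ω → ψ x ≤ ((u + w : W₀ N s Ω) : Space d → ℝ) x
    filter_upwards [h1, hw] with x h2 h3 hx
    simp only [Pi.zero_apply] at h3
    rw [Submodule.coe_add, Pi.add_apply]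
    linarith [h2 hx]
  have h := hu.2 _ hmem
  rw [add_sub_cancel_left, pairing_sub] at h
  linarith

/-! ### Lattice operations in the dual and the order dual -/

theorem sub_le_iff_le_add_dual {A B C : Dual N s Ω} : A - B ≤ C ↔ A ≤ B + C := by
  refine forall_congr' fun v => imp_congr_right fun _ => ?_
  rw [pairing_sub, pairing_add, sub_le_iff_le_add']

theorem isLUB_add_of_isLUB_sub {A F P : Dual N s Ω} (h : IsLUB {A - F, 0} P) :
    IsLUB {F, A} (F + P) := by
  refine ⟨?_, fun M hM => ?_⟩
  · rintro B (rfl | rfl) v hv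
    · have : pairing 0 v ≤ pairing P v := h.1 (by simp) v hv
      simp only [pairing_add, pairing_zero] at this ⊢
      linarith
    · exact sub_le_iff_le_add_dual.1 (h.1 (by simp)) v hv
  · have h2 : P ≤ M - F := h.2 (by
      rintro B (rfl | rfl) v hv
      · have := hM (by simp : A ∈ ({F, A} : Set (Dual N s Ω))) v hv
        simp only [pairing_sub]
        linarith
      · have := hM (by simp : F ∈ ({F, A} : Set (Dual N s Ω))) v hv
        simp only [pairing_sub, pairing_zero]
        linarith)
    intro v hv
    have := h2 v hv
    simp only [pairing_sub, pairing_add] at this ⊢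
    linarith

theorem isGLB_sub_of_isLUB_sub {A F Q : Dual N s Ω} (h : IsLUB {A - F, 0} Q) :
    IsGLB {F, A} (A - Q) := by
  refine ⟨?_, fun m hm => ?_⟩
  · rintro B (rfl | rfl) v hv
    · have : pairing (A - B) v ≤ pairing Q v := h.1 (by simp) v hv
      simp only [pairing_sub] at this ⊢
      linarith
    · have : pairing 0 v ≤ pairing Q v := h.1 (by simp) v hv
      simp only [pairing_sub, pairing_zero] at this ⊢
      linarith
  · have h2 : Q ≤ A - m := h.2 (by
      rintro B (rfl | rfl) v hv
      · have := hm (by simp : F ∈ ({F, A} : Set (Dual N s Ω))) v hv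
        simp only [pairing_sub]
        linarith
      · have := hm (by simp : A ∈ ({F, A} : Set (Dual N s Ω))) v hv
        simp only [pairing_sub, pairing_zero]
        linarith)
    intro v hv
    have := h2 v hv
    simp only [pairing_sub] at this ⊢
    linarith

/-- The order dual contains everything below `F + P` when `F` and `P` lie in it. -/
theorem mem_orderDual_of_le_add {F P X : Dual N s Ω} (hF : F ∈ orderDual N s Ω)
    (hP : P ∈ orderDual N s Ω) (hX : X ≤ F + P) : X ∈ orderDual N s Ω := by
  obtain ⟨A, B, hA, hB, rfl⟩ := hF
  obtain ⟨A', B', hA', hB', rfl⟩ := hP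
  refine ⟨A + A', A + A' - X, ?_, ?_, by abel⟩
  · intro v hv
    have h1 := hA v hv
    have h2 := hA' v hv
    simp only [pairing_add, pairing_zero] at h1 h2 ⊢
    linarith
  · intro v hv
    have h1 := hB v hv
    have h2 := hB' v hv
    have h3 := hX v hv
    simp only [pairing_add, pairing_sub, pairing_zero] at h1 h2 h3 ⊢
    linarith

end Monotone

end FracOrlicz

theorem mainTheorem2 {d : ℕ} (N : FracOrlicz.Nonlinearity d) (s : ℝ) (hs0 : 0 < s) (hs1 : s < 1)
    (Ω : Set (FracOrlicz.Space d)) (hΩo : IsOpen Ω) (hΩb : Bornology.IsBounded Ω)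
    (F : FracOrlicz.Dual N s Ω) (hF : F ∈ FracOrlicz.orderDual N s Ω)
    (ψ : FracOrlicz.W N s)
    (hψ : (ψ : FracOrlicz.Space d → ℝ) ∈ FracOrlicz.W₀ N s Set.univ)
    (hψ0 : ∀ᵐ x, x ∉ Ω → (ψ : FracOrlicz.Space d → ℝ) x ≤ 0)
    (hψF : FracOrlicz.PosPartMemOrderDual (FracOrlicz.Lg Ω ψ - F)) :
    (∀ u : FracOrlicz.W₀ N s Ω, FracOrlicz.IsSolution (FracOrlicz.K₁ N s Ω ψ) F u →
      F ≤ FracOrlicz.Lg Ω (FracOrlicz.toW u) ∧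
      (∃ M, IsLUB {F, FracOrlicz.Lg Ω ψ} M ∧ FracOrlicz.Lg Ω (FracOrlicz.toW u) ≤ M) ∧
      FracOrlicz.Lg Ω (FracOrlicz.toW u) ∈ FracOrlicz.orderDual N s Ω) ∧
    (∀ φ : FracOrlicz.W N s,
      (φ : FracOrlicz.Space d → ℝ) ∈ FracOrlicz.W₀ N s Set.univ →
      (∀ᵐ x, x ∉ Ω → 0 ≤ (φ : FracOrlicz.Space d → ℝ) x) →
      FracOrlicz.PosPartMemOrderDual (FracOrlicz.Lg Ω φ - F) →
      ∀ u : FracOrlicz.W₀ N s Ω, FracOrlicz.IsSolution (FracOrlicz.K₂ N s Ω ψ φ) F u →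
        (∃ m, IsGLB {F, FracOrlicz.Lg Ω φ} m ∧ m ≤ FracOrlicz.Lg Ω (FracOrlicz.toW u)) ∧
        (∃ M, IsLUB {F, FracOrlicz.Lg Ω ψ} M ∧ FracOrlicz.Lg Ω (FracOrlicz.toW u) ≤ M) ∧
        FracOrlicz.Lg Ω (FracOrlicz.toW u) ∈ FracOrlicz.orderDual N s Ω) := by
  obtain ⟨P, hPmem, hP⟩ := hψF
  have hP0 : 0 ≤ P := hP.1 (by simp)
  have hψP : FracOrlicz.Lg Ω ψ - F ≤ P := hP.1 (by simp)
  have hM := FracOrlicz.isLUB_add_of_isLUB_sub hP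
  refine ⟨fun u hu => ?_, fun φ hφ hφ0 hφF u hu => ?_⟩
  · have hup : FracOrlicz.Lg Ω (FracOrlicz.toW u) ≤ F + P :=
      FracOrlicz.sub_le_iff_le_add_dual.1
        (FracOrlicz.Lg_sub_le_of_isSolution hψ hψ0 hP0 hψP hu hu.1 fun v hv _ => hv)
    exact ⟨FracOrlicz.le_Lg_of_isSolution_K₁ hu, ⟨_, hM, hup⟩,
      FracOrlicz.mem_orderDual_of_le_add hF hPmem hup⟩
  · obtain ⟨Q, -, hQ⟩ := hφF
    have hQ0 : 0 ≤ Q := hQ.1 (by simp)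
    have hφQ : FracOrlicz.Lg Ω φ - F ≤ Q := hQ.1 (by simp)
    have huK : ∀ᵐ x, x ∈ Ω → (ψ : FracOrlicz.Space d → ℝ) x ≤ (u : FracOrlicz.Space d → ℝ) x ∧
        (u : FracOrlicz.Space d → ℝ) x ≤ (φ : FracOrlicz.Space d → ℝ) x := hu.1
    have hup : FracOrlicz.Lg Ω (FracOrlicz.toW u) ≤ F + P := by
      refine FracOrlicz.sub_le_iff_le_add_dual.1
        (FracOrlicz.Lg_sub_le_of_isSolution hψ hψ0 hP0 hψP hu (huK.mono fun x h hx => (h hx).1)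
          fun v hv hvu => ?_)
      change ∀ᵐ x, x ∈ Ω → _
      filter_upwards [hv, hvu, huK] with x h1 h2 h3 hx
      exact ⟨h1 hx, h2.trans (h3 hx).2⟩
    -- `R = F - F ∧ 𝓛 φ` is a nonnegative functional above `F - 𝓛 φ`.
    have hR : F - FracOrlicz.Lg Ω (FracOrlicz.toW u) ≤ F - FracOrlicz.Lg Ω φ + Q := by
      refine FracOrlicz.sub_Lg_le_of_isSolution hφ hφ0 ?_ ?_ hu (huK.mono fun x h hx => (h hx).2)
        fun v hv huv => ?_
      · intro v hv
        have := hφQ v hv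
        simp only [FracOrlicz.pairing_sub, FracOrlicz.pairing_add, FracOrlicz.pairing_zero] at this ⊢
        linarith
      · intro v hv
        have := hQ0 v hv
        simp only [FracOrlicz.pairing_add, FracOrlicz.pairing_zero] at this ⊢
        linarith
      · change ∀ᵐ x, x ∈ Ω → _
        filter_upwards [hv, huv, huK] with x h1 h2 h3 hx
        exact ⟨(h3 hx).1.trans h2, h1 hx⟩
    refine ⟨⟨_, FracOrlicz.isGLB_sub_of_isLUB_sub hQ, fun v hv => ?_⟩, ⟨_, hM, hup⟩,
      FracOrlicz.mem_orderDual_of_le_add hF hPmem hup⟩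
    have := hR v hv
    simp only [FracOrlicz.pairing_sub, FracOrlicz.pairing_add] at this ⊢
    linarith
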